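/- Let $\varphi$ be an Orlicz $N$-function (continuous, even, convex, $\varphi(0)=0$, $\varphi(x)>0$ for $x\ne0$, $\varphi(x)/x\to0$ as $x\to0$, $\varphi(x)/x\to\infty$ as $x\to\infty$) with $\liminf_{x\to0}\varphi(x)/x^2>0$, and let $\varphi^*(x)=\sup_{y\in\mathbb R}(xy-\varphi(y))$. A random variable $\zeta$ is $\varphi$-sub-Gaussian if $\mathsf E\zeta=0$ and $\mathsf Ee^{\lambda\zeta}\le e^{\varphi(a\lambda)}$ for some $a>0$ and all $\lambda\in\mathbb R$; $\tau_\varphi(\zeta)$ is the infimum of such $a$. A family $\Delta$ of $\varphi$-sub-Gaussian variables is strictly $\varphi$-sub-Gaussian with determining constant $C_\Delta\ge 0$ if $\tau_\varphi(\zeta)\le C_\Delta(\mathsf E\zeta^2)^{1/2}$ for all linear combinations $\zeta$ of elements of $\Delta$. Let $Z$ be an admissible function for $\varphi$ with constant $u_0\ge0$: $Z$ is continuous and strictly increasing on $[0,\infty)$, positive on $(0,\infty)$, unbounded, $u/Z(u)$ is non-decreasing for $u>u_0$, and $\int_0^\varepsilon\Psi\big(\ln(Z^{(-1)}(1/s)-u_0)\big)\,ds<\infty$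 for some $\varepsilon>0$, where $\Psi(v)=v/\varphi^{(-1)}(v)$ and $\varphi^{(-1)}$ is the inverse of $\varphi$ on $[0,\infty)$. Let $y=\{y(u),u\in\mathbb R\}$ be a real strictly $\varphi$-sub-Gaussian process with determining constant $C_y$ whose covariance function $\Gamma_y(s,t)=\mathsf Ey(s)y(t)$ has finite (Vitali) variation on $\mathbb R^2$. Let $\kappa=\cos$ or $\kappa=\sin$, let $a_1,\dots,a_N\in\mathbb R$, and let $a\le b$, $c\le d$ with $\varkappa=\max(b-a,d-c)>0$. Assume that for $a\le t\le b$, $c\le x\le d$ the mean-square integrals $$U(t,x)=\int_{-\infty}^{\infty}\kappa\Big(\lambda x+t\sum_{k=1}^Na_k\lambda^{2k+1}(-1)^k\Big)\,dy(\lambda)$$ exist and that $U$ is continuous on $[a,b]\times[c,d]$ with probability one. (Formally, $U$ is the solution of $\sum_{k=1}^Na_k\,\partial^{2k+1}U/\partial x^{2k+1}=\partial U/\partial t$ with the harmonizable initial condition $U(0,x)=\int\kappa(\lambda x)\,dy(\lambda)$.) Put $w(\lambda)=Z\big(\tfrac{|\lambda|}2+u_0\big)+Z\big(\tfrac12\big|\sum_{k=1}^Na_k\lambda^{2k+1}(-1)^k\big|+u_0\big)$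 and assume that $$C_Z^2=\int_{-\infty}^\infty\int_{-\infty}^\infty w(\lambda)w(\mu)\,d|\Gamma_y(\lambda,\mu)|<\infty .$$ Put $\sigma(h)=2C_yC_Z/Z(1/h+u_0)$ for $0<h\le\varkappa$, $\gamma_0=\sigma(\varkappa)$ and $\varepsilon_0=\sup_{a\le t\le b,\,c\le x\le d}\tau_\varphi(U(t,x))$. Let $r:[1,\infty)\to[0,\infty)$ be strictly increasing, with $x\mapsto r(e^x)$ convex on $[0,\infty)$, and assume that for $0<\varepsilon\le\gamma_0$ $$\int_0^\varepsilon r\Big(\Big(\frac{b-a}{2\sigma^{(-1)}(v)}+1\Big)\Big(\frac{d-c}{2\sigma^{(-1)}(v)}+1\Big)\Big)dv<\infty .$$ For $0\le\delta\le\gamma_0$ let $$\hat I_r(\delta)=\int_0^\delta r\Big(\Big(\tfrac{b-a}2\big(Z^{(-1)}\big(\tfrac{2C_ZC_y}s\big)-u_0\big)+1\Big)\Big(\tfrac{d-c}2\big(Z^{(-1)}\big(\tfrac{2C_ZC_y}s\big)-u_0\big)+1\Big)\Big)ds .$$ Then for all $0<\theta<1$ and $u>0$ $$\mathsf P\Big\{\sup_{a\le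 t\le b,\ c\le x\le d}|U(t,x)|>u\Big\}\le 2\exp\Big\{-\varphi^*\Big(\frac{u(1-\theta)}{\varepsilon_0}\Big)\Big\}\;r^{(-1)}\Big(\frac{\hat I_r(\min(\theta\varepsilon_0,\gamma_0))+r(1)\max(\theta\varepsilon_0-\gamma_0,0)}{\theta\varepsilon_0}\Big),$$ where $r^{(-1)}$ is the inverse of $r$ (if $\varepsilon_0=0$, the probability is $0$). The term with $r(1)$ vanishes if $r(1)=0$ (for example $r(v)=\ln v$ or $r(v)=v^\beta-1$, $\beta>0$) or if $\theta\varepsilon_0\le\gamma_0$. -/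

import Mathlib

open MeasureTheory ProbabilityTheory Set Filter Topology
open scoped ENNReal

noncomputable section

namespace PhiSub

/-- An Orlicz `N`-function that satisfies condition `Q`, that is,
`liminf φ x / x ^ 2 > 0` as `x → 0` (the value `∞` being allowed). -/
structure IsNFunctionQ (φ : ℝ → ℝ) : Prop where
  continuous : Continuous φ
  even : ∀ x, φ (-x) = φ x
  convex : ConvexOn ℝ univ φ
  zero : φ 0 = 0
  pos : ∀ x, x ≠ 0 → 0 < φ x
  tendsto_zero : Tendsto (fun x => φ x / x) (𝓝[≠] 0) (𝓝 0)
  tendsto_top : Tendsto (fun x => φ x / x) atTop atTop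
  condQ : ∃ c : ℝ, 0 < c ∧ ∀ᶠ x in 𝓝[≠] 0, c ≤ φ x / x ^ 2

/-- The Young--Fenchel transform (convex conjugate) of `φ`. -/
def conj (φ : ℝ → ℝ) (x : ℝ) : ℝ := ⨆ y : ℝ, (x * y - φ y)

/-- The function `Ψ v = v / φ⁻¹ v`, with `φ⁻¹` the inverse of `φ` on `[0, ∞)`. -/
def Psi (φ : ℝ → ℝ) (v : ℝ) : ℝ := v / Function.invFunOn φ (Ici 0) v

/-- The inverse of a function `Z` given on `[0, ∞)`. -/
def invZ (Z : ℝ → ℝ) (v : ℝ) : ℝ := Function.invFunOn Z (Ici 0) v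

/-- The inverse of a function `r` given on `[1, ∞)`. -/
def invR (r : ℝ → ℝ) (v : ℝ) : ℝ := Function.invFunOn r (Ici 1) v

/-- `Z` (a function on `[0, ∞)`), with the constant `u₀`, is admissible for the space
`Sub_φ`. Divergence of `Z` at infinity is what makes `Z⁻¹ (1 / s)` meaningful for all small
`s > 0`. -/
structure IsAdmissible (φ Z : ℝ → ℝ) (u₀ : ℝ) : Prop where
  u₀_nonneg : 0 ≤ u₀
  continuousOn : ContinuousOn Z (Ici 0)
  strictMonoOn : StrictMonoOn Z (Ici 0)
  pos : ∀ u, 0 < u → 0 < Z u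
  ratio_mono : MonotoneOn (fun u => u / Z u) (Ioi u₀)
  tendsto_top : Tendsto Z atTop atTop
  integral_lt_top : ∃ ε : ℝ, 0 < ε ∧
    IntegrableOn (fun s => Psi φ (Real.log (invZ Z (1 / s) - u₀))) (Ioc 0 ε)

variable {Ω : Type*} [MeasurableSpace Ω]

/-- The random variable `ζ` is `φ`-sub-Gaussian. -/
structure IsPhiSubGaussian (φ : ℝ → ℝ) (μ : Measure Ω) (ζ : Ω → ℝ) : Prop where
  integrable : Integrable ζ μ
  mean_zero : ∫ ω, ζ ω ∂μ = 0
  integrable_exp : ∀ l : ℝ, Integrable (fun ω => Real.exp (l * ζ ω)) μ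
  bound : ∃ a : ℝ, 0 < a ∧ ∀ l : ℝ, ∫ ω, Real.exp (l * ζ ω) ∂μ ≤ Real.exp (φ (l * a))

/-- The `φ`-sub-Gaussian standard of a random variable. -/
def tau (φ : ℝ → ℝ) (μ : Measure Ω) (ζ : Ω → ℝ) : ℝ :=
  sInf {a : ℝ | 0 < a ∧ ∀ l : ℝ, Integrable (fun ω => Real.exp (l * ζ ω)) μ ∧
    ∫ ω, Real.exp (l * ζ ω) ∂μ ≤ Real.exp (φ (a * l))}

/-- The family `y` is strictly `φ`-sub-Gaussian with determining constant `C`. Only finite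
linear combinations are required to satisfy the inequality; it passes to mean-square convergent
series by taking limits. -/
structure IsStrictlyPhiSubGaussian {T : Type*} (φ : ℝ → ℝ) (μ : Measure Ω) (y : T → Ω → ℝ)
    (C : ℝ) : Prop where
  nonneg : 0 ≤ C
  mem : ∀ i, IsPhiSubGaussian φ μ (y i)
  le : ∀ (s : Finset T) (c : T → ℝ),
    tau φ μ (fun ω => ∑ i ∈ s, c i * y i ω) ≤
      C * Real.sqrt (∫ ω, (∑ i ∈ s, c i * y i ω) ^ 2 ∂μ)

/-- The covariance function `Γ_y (s, t) = E y(s) y(t)` of a centered process. -/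
def covFun (μ : Measure Ω) (y : ℝ → Ω → ℝ) (s t : ℝ) : ℝ := ∫ ω, y s ω * y t ω ∂μ

/-- A tagged partition `A = pt 0 ≤ pt 1 ≤ … ≤ pt n = B` of `[A, B]`, with
`tag i ∈ [pt i, pt (i + 1)]`. -/
structure TaggedGrid (A B : ℝ) where
  n : ℕ
  pt : ℕ → ℝ
  tag : ℕ → ℝ
  mono : Monotone pt
  first : pt 0 = A
  last : pt n = B
  tag_mem : ∀ i, i < n → tag i ∈ Icc (pt i) (pt (i + 1))

/-- All cells of the partition have length at most `δ`. -/
def TaggedGrid.MeshLE {A B : ℝ} (P : TaggedGrid A B) (δ : ℝ) : Prop :=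
  ∀ i, i < P.n → P.pt (i + 1) - P.pt i ≤ δ

/-- The Riemann--Stieltjes sum of `f` against the increments of `y`. -/
def TaggedGrid.sum {A B : ℝ} (P : TaggedGrid A B) (f : ℝ → ℝ) (y : ℝ → Ω → ℝ) (ω : Ω) : ℝ :=
  ∑ i ∈ Finset.range P.n, f (P.tag i) * (y (P.pt (i + 1)) ω - y (P.pt i) ω)

/-- `J` is the mean-square integral `∫_A^B f(λ) dy(λ)`: the Riemann--Stieltjes sums converge to
`J` in `L²` as the mesh tends to zero. -/
def IsMSIntegralOn (μ : Measure Ω) (f : ℝ → ℝ) (y : ℝ → Ω → ℝ) (A B : ℝ) (J : Ω → ℝ) : Prop :=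
  MemLp J 2 μ ∧ ∀ ε : ℝ, 0 < ε → ∃ δ : ℝ, 0 < δ ∧ ∀ P : TaggedGrid A B, P.MeshLE δ →
    eLpNorm (fun ω => P.sum f y ω - J ω) 2 μ ≤ ENNReal.ofReal ε

/-- `X` is the mean-square integral `∫_{-∞}^{∞} f(λ) dy(λ)`: the `L²`-limit of the mean-square
integrals over `[A, B]` as `A → -∞`, `B → ∞`. -/
def IsMSIntegral (μ : Measure Ω) (f : ℝ → ℝ) (y : ℝ → Ω → ℝ) (X : Ω → ℝ) : Prop :=
  MemLp X 2 μ ∧ ∃ J : ℝ → ℝ → Ω → ℝ,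
    (∀ A B, A < B → IsMSIntegralOn μ f y A B (J A B)) ∧
    Tendsto (fun p : ℝ × ℝ => eLpNorm (fun ω => J p.1 p.2 ω - X ω) 2 μ)
      (atBot ×ˢ atTop) (𝓝 0)

/-- The increment of `G` over the rectangle `(s, s'] × (t, t']`. -/
def rectIncr (G : ℝ → ℝ → ℝ) (s s' t t' : ℝ) : ℝ := G s' t' - G s t' - G s' t + G s t

/-- The integral `∫∫ f(s, t) |dG(s, t)|` of a nonnegative continuous function against the
absolute variation of `G`: the limit, as the grids are refined and exhaust the plane, of
`∑ ∑ f(s, t) |Δ_i Δ_j G|`. It is written as the supremum of the lower sums, which increase under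
refinement. -/
def varIntegral (G : ℝ → ℝ → ℝ) (f : ℝ → ℝ → ℝ≥0∞) : ℝ≥0∞ :=
  ⨆ (n : ℕ) (m : ℕ) (p : ℕ → ℝ) (q : ℕ → ℝ) (_ : Monotone p) (_ : Monotone q),
    ∑ i ∈ Finset.range n, ∑ j ∈ Finset.range m,
      (⨅ s ∈ Icc (p i) (p (i + 1)), ⨅ t ∈ Icc (q j) (q (j + 1)), f s t) *
        ENNReal.ofReal |rectIncr G (p i) (p (i + 1)) (q j) (q (j + 1))|

/-- `G` has finite (Vitali) variation on the plane. -/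
def HasFiniteVitaliVariation (G : ℝ → ℝ → ℝ) : Prop := varIntegral G (fun _ _ => 1) < ∞

/-- The dispersion symbol `∑_{k=1}^N a_k λ^{2k+1} (-1)^k`. -/
def symb (N : ℕ) (a : ℕ → ℝ) (l : ℝ) : ℝ :=
  ∑ k ∈ Finset.Icc 1 N, a k * l ^ (2 * k + 1) * (-1) ^ k

/-- The kernel `I(t, x, λ) = κ(λ x + t ∑_{k=1}^N a_k λ^{2k+1} (-1)^k)`. -/
def kernelI (κ : ℝ → ℝ) (N : ℕ) (a : ℕ → ℝ) (t x l : ℝ) : ℝ := κ (l * x + t * symb N a l)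

/-- The factor `Z(|λ|/2 + u₀) + Z(|∑ a_k λ^{2k+1} (-1)^k|/2 + u₀)`. -/
def weight (Z : ℝ → ℝ) (u₀ : ℝ) (N : ℕ) (a : ℕ → ℝ) (l : ℝ) : ℝ :=
  Z (|l| / 2 + u₀) + Z (1 / 2 * |symb N a l| + u₀)

/-- The integral that defines `C_Z ^ 2`, with values in `[0, ∞]`. -/
def CZsq (G : ℝ → ℝ → ℝ) (Z : ℝ → ℝ) (u₀ : ℝ) (N : ℕ) (a : ℕ → ℝ) : ℝ≥0∞ :=
  varIntegral G (fun l m => ENNReal.ofReal (weight Z u₀ N a l * weight Z u₀ N a m))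

/-- The constant `C_Z`. -/
def CZ (G : ℝ → ℝ → ℝ) (Z : ℝ → ℝ) (u₀ : ℝ) (N : ℕ) (a : ℕ → ℝ) : ℝ :=
  Real.sqrt (CZsq G Z u₀ N a).toReal

/-- `σ(h) = 2 C / Z(1/h + u₀)`, where `C = C_y C_Z`. -/
def sigma (Z : ℝ → ℝ) (u₀ C : ℝ) (h : ℝ) : ℝ := 2 * C / Z (1 / h + u₀)

/-- The inverse of `σ` on `(0, H]`. -/
def invSigma (σ : ℝ → ℝ) (H v : ℝ) : ℝ := Function.invFunOn σ (Ioc 0 H) v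

/-- The integrand of the entropy integral `Ĩ_r` on a rectangle with sides `L₁`, `L₂`. -/
def entropyIntegrand (r σ : ℝ → ℝ) (L₁ L₂ v : ℝ) : ℝ :=
  r ((L₁ / (2 * invSigma σ (max L₁ L₂) v) + 1) * (L₂ / (2 * invSigma σ (max L₁ L₂) v) + 1))

/-- The integral `Î_r(δ)` on a rectangle with sides `L₁`, `L₂`, where `C = C_y C_Z`. -/
def hatI (r Z : ℝ → ℝ) (u₀ C L₁ L₂ δ : ℝ) : ℝ :=
  ∫ s in (0 : ℝ)..δ, r ((L₁ / 2 * (invZ Z (2 * C / s) - u₀) + 1) *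
    (L₂ / 2 * (invZ Z (2 * C / s) - u₀) + 1))

/-- `ε₀ = sup τ_φ(U(t, x))` over the rectangle `[a, b] × [c, d]`. -/
def eps0 (φ : ℝ → ℝ) (μ : Measure Ω) (U : ℝ → ℝ → Ω → ℝ) (a b c d : ℝ) : ℝ :=
  sSup ((fun p : ℝ × ℝ => tau φ μ (U p.1 p.2)) '' (Icc a b ×ˢ Icc c d))

end PhiSub

end

/-!
Strict sub-Gaussianity passes to mean-square limits and turns an `L²` bound into an exponential
one: `E exp (l ζ) ≤ exp (φ (C l ‖ζ‖₂))` for every mean-square integral `ζ` against `y`. The kernel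
of `U (t, x) - U (t', x')` is at most `2 |sin ((x - x') λ / 2)| + 2 |sin ((t - t') ψ λ / 2)|`,
where `ψ` is the dispersion symbol, and the monotonicity of `u / Z u` gives
`|sin (s λ / 2)| ≤ Z (|λ| / 2 + u₀) / Z (1 / h + u₀)` for `|s| ≤ h`.
Hence the increments of `U` over distances at most
`h` are bounded by `σ h`, and a grid in the rectangle is a `v`-net for `U` of cardinality at most
`N v`, the product in the entropy integral.

The supremum is bounded by chaining along the nets of radii `θ ^ (k + 1) ε₀`. The link of level
`k` has standard at most `θ ^ k ε₀`, so Hölder's inequality with weights `(1 - θ) θ ^ k` puts the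
same exponent `φ (ε₀ l / (1 - θ))` on all links; the cardinalities enter as
`∏ N (θ ^ (k + 1) ε₀) ^ ((1 - θ) θ ^ k)`.
Jensen's inequality for the convex function `r ∘ exp` bounds `r` of this
product by a lower sum for the average of `r ∘ N` over `(0, θ ε₀]`. Optimising over `l` in
Markov's inequality produces `φ*`.
-/

namespace PhiSub

section Young

/-- A Young function: an `N`-function without its growth conditions at `0` and `∞` and without
strict positivity. -/
structure IsYoungFunction (φ : ℝ → ℝ) : Prop where
  even : ∀ x, φ (-x) = φ x
  convex : ConvexOn ℝ univ φ
  zero : φ 0 = 0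

theorem IsNFunctionQ.isYoungFunction {φ : ℝ → ℝ} (hφ : IsNFunctionQ φ) : IsYoungFunction φ :=
  ⟨hφ.even, hφ.convex, hφ.zero⟩

namespace IsYoungFunction

variable {φ : ℝ → ℝ} (hφ : IsYoungFunction φ)
include hφ

theorem apply_abs (x : ℝ) : φ |x| = φ x := by
  rcases abs_choice x with h | h <;> rw [h]
  exact hφ.even x

theorem apply_le_apply_of_abs_le_abs {x y : ℝ} (h : |x| ≤ |y|) : φ x ≤ φ y := by
  have := hφ.convex.le_max_of_mem_Icc (mem_univ (-|y|)) (mem_univ |y|) (abs_le.1 h)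
  rwa [hφ.even, max_self, hφ.apply_abs] at this

theorem nonneg (x : ℝ) : 0 ≤ φ x :=
  hφ.zero ▸ hφ.apply_le_apply_of_abs_le_abs (by simp)

theorem continuous : Continuous φ :=
  continuousOn_univ.1 (hφ.convex.continuousOn isOpen_univ)

end IsYoungFunction

end Young

section MGFBound

variable {Ω : Type*} [MeasurableSpace Ω] {μ : Measure Ω} {φ : ℝ → ℝ} {ζ ξ : Ω → ℝ} {a b : ℝ}

/-- The moment generating function of `ζ` is bounded by `exp (φ (a * l))`. Stated with the lower
Lebesgue integral, so that integrability of the exponentials is part of the bound. -/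
structure HasMGFBound (φ : ℝ → ℝ) (μ : Measure Ω) (ζ : Ω → ℝ) (a : ℝ) : Prop where
  aemeasurable : AEMeasurable ζ μ
  le : ∀ l : ℝ,
    ∫⁻ ω, ENNReal.ofReal (Real.exp (l * ζ ω)) ∂μ ≤ ENNReal.ofReal (Real.exp (φ (a * l)))

namespace HasMGFBound

theorem mono (hφ : IsYoungFunction φ) (h : HasMGFBound φ μ ζ a) (hab : |a| ≤ |b|) :
    HasMGFBound φ μ ζ b := by
  refine ⟨h.aemeasurable, fun l => (h.le l).trans ?_⟩
  gcongr
  refine hφ.apply_le_apply_of_abs_le_abs ?_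
  rw [abs_mul, abs_mul]
  gcongr

theorem aemeasurable_ofReal_exp (h : HasMGFBound φ μ ζ a) (l : ℝ) :
    AEMeasurable (fun ω => ENNReal.ofReal (Real.exp (l * ζ ω))) μ :=
  (Real.measurable_exp.comp_aemeasurable (h.aemeasurable.const_mul l)).ennreal_ofReal

theorem integrable_exp (h : HasMGFBound φ μ ζ a) (l : ℝ) :
    Integrable (fun ω => Real.exp (l * ζ ω)) μ := by
  refine ⟨(Real.measurable_exp.comp_aemeasurable
    (h.aemeasurable.const_mul l)).aestronglyMeasurable, ?_⟩
  rw [hasFiniteIntegral_iff_ofReal (ae_of_all _ fun ω => (Real.exp_pos _).le)]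
  exact (h.le l).trans_lt ENNReal.ofReal_lt_top

end HasMGFBound

theorem hasMGFBound_iff : HasMGFBound φ μ ζ a ↔ AEMeasurable ζ μ ∧
    ∀ l : ℝ, Integrable (fun ω => Real.exp (l * ζ ω)) μ ∧
      ∫ ω, Real.exp (l * ζ ω) ∂μ ≤ Real.exp (φ (a * l)) := by
  have ofReal_integral {l : ℝ} (h : Integrable (fun ω => Real.exp (l * ζ ω)) μ) :=
    ofReal_integral_eq_lintegral_ofReal h (ae_of_all _ fun ω => (Real.exp_pos _).le)
  refine ⟨fun h => ⟨h.aemeasurable, fun l => ⟨h.integrable_exp l, ?_⟩⟩,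
    fun h => ⟨h.1, fun l => ?_⟩⟩
  · rw [← ENNReal.ofReal_le_ofReal_iff (Real.exp_pos _).le, ofReal_integral (h.integrable_exp l)]
    exact h.le l
  · rw [← ofReal_integral (h.2 l).1]
    exact ENNReal.ofReal_le_ofReal (h.2 l).2

theorem tau_nonneg (ζ : Ω → ℝ) : 0 ≤ tau φ μ ζ := Real.sInf_nonneg fun _ h => h.1.le

theorem hasMGFBound_zero [IsProbabilityMeasure μ] (hφ : IsYoungFunction φ) (a : ℝ) :
    HasMGFBound φ μ (fun _ => 0) a :=
  ⟨aemeasurable_const, fun l => by simpa using hφ.nonneg (a * l)⟩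

namespace HasMGFBound

theorem tau_le (hφ : IsYoungFunction φ) (h : HasMGFBound φ μ ζ a) (ha : 0 ≤ a) :
    tau φ μ ζ ≤ a := by
  refine le_of_forall_gt_imp_ge_of_dense fun b hb => ?_
  exact csInf_le ⟨0, fun _ h => h.1.le⟩
    ⟨ha.trans_lt hb, (hasMGFBound_iff.1 (h.mono hφ (abs_le_abs_of_nonneg ha hb.le))).2⟩

theorem hasMGFBound_tau (hφ : Continuous φ) (h : HasMGFBound φ μ ζ a) (ha : 0 < a) :
    HasMGFBound φ μ ζ (tau φ μ ζ) := by
  refine ⟨h.aemeasurable, fun l => ?_⟩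
  obtain ⟨s, -, hs, hmem⟩ := exists_seq_tendsto_sInf (S := {a : ℝ | 0 < a ∧ ∀ l : ℝ,
    Integrable (fun ω => Real.exp (l * ζ ω)) μ ∧
    ∫ ω, Real.exp (l * ζ ω) ∂μ ≤ Real.exp (φ (a * l))}) ⟨a, ha, (hasMGFBound_iff.1 h).2⟩
    ⟨0, fun _ h => h.1.le⟩
  have hcont : Continuous fun x : ℝ => ENNReal.ofReal (Real.exp (φ (x * l))) :=
    ENNReal.continuous_ofReal.comp (by fun_prop)
  exact ge_of_tendsto' ((hcont.tendsto _).comp hs) fun n =>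
    (hasMGFBound_iff.2 ⟨h.aemeasurable, (hmem n).2⟩).le l

theorem const_mul (h : HasMGFBound φ μ ζ a) (c : ℝ) :
    HasMGFBound φ μ (fun ω => c * ζ ω) (a * c) := by
  refine ⟨h.aemeasurable.const_mul c, fun l => ?_⟩
  simpa only [mul_assoc, mul_left_comm l c, mul_comm l c] using h.le (l * c)

theorem add (hζ : HasMGFBound φ μ ζ a) (hξ : HasMGFBound φ μ ξ b) (ha : 0 < a) (hb : 0 < b) :
    HasMGFBound φ μ (fun ω => ζ ω + ξ ω) (a + b) := by
  refine ⟨hζ.aemeasurable.add hξ.aemeasurable, fun l => ?_⟩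
  -- Hölder's inequality with the weights that make both factors carry the exponent `(a + b) * l`.
  set p := a / (a + b) with hp
  set q := b / (a + b) with hq
  have hp_pos : 0 < p := by positivity
  have hq_pos : 0 < q := by positivity
  have hpq : p + q = 1 := by rw [hp, hq]; field_simp
  have hpa : a * (l / p) = (a + b) * l := by rw [hp]; field_simp
  have hqb : b * (l / q) = (a + b) * l := by rw [hq]; field_simp
  have ofReal_exp_rpow (x s y t : ℝ) : ENNReal.ofReal (Real.exp x) ^ s *
      ENNReal.ofReal (Real.exp y) ^ t = ENNReal.ofReal (Real.exp (x * s + y * t)) := by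
    rw [ENNReal.ofReal_rpow_of_pos (Real.exp_pos _), ENNReal.ofReal_rpow_of_pos (Real.exp_pos _),
      ← ENNReal.ofReal_mul (by positivity), ← Real.exp_mul, ← Real.exp_mul, ← Real.exp_add]
  calc ∫⁻ ω, ENNReal.ofReal (Real.exp (l * (ζ ω + ξ ω))) ∂μ
      = ∫⁻ ω, ENNReal.ofReal (Real.exp (l / p * ζ ω)) ^ p *
          ENNReal.ofReal (Real.exp (l / q * ξ ω)) ^ q ∂μ := by
        refine lintegral_congr fun ω => ?_
        rw [ofReal_exp_rpow]
        congr 2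
        field_simp
    _ ≤ (∫⁻ ω, ENNReal.ofReal (Real.exp (l / p * ζ ω)) ∂μ) ^ p *
          (∫⁻ ω, ENNReal.ofReal (Real.exp (l / q * ξ ω)) ∂μ) ^ q :=
        ENNReal.lintegral_mul_norm_pow_le (hζ.aemeasurable_ofReal_exp _)
          (hξ.aemeasurable_ofReal_exp _) hp_pos.le hq_pos.le hpq
    _ ≤ ENNReal.ofReal (Real.exp (φ ((a + b) * l))) ^ p *
          ENNReal.ofReal (Real.exp (φ ((a + b) * l))) ^ q := by
        gcongr
        · exact hpa ▸ hζ.le (l / p)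
        · exact hqb ▸ hξ.le (l / q)
    _ = ENNReal.ofReal (Real.exp (φ ((a + b) * l))) := by
        rw [ofReal_exp_rpow, ← mul_add, hpq, mul_one]

theorem of_tendstoInMeasure (hφ : Continuous φ) {ξ : ℕ → Ω → ℝ} {c : ℕ → ℝ}
    (h : ∀ n, HasMGFBound φ μ (ξ n) (c n)) (hc : Tendsto c atTop (𝓝 a))
    (hξ : TendstoInMeasure μ ξ atTop ζ) : HasMGFBound φ μ ζ a := by
  obtain ⟨ns, hns, hae⟩ := hξ.exists_seq_tendsto_ae
  refine ⟨hξ.aemeasurable fun n => (h n).aemeasurable, fun l => ?_⟩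
  have hcont : Continuous fun x : ℝ => ENNReal.ofReal (Real.exp (l * x)) :=
    ENNReal.continuous_ofReal.comp (by fun_prop)
  have hcont' : Continuous fun x : ℝ => ENNReal.ofReal (Real.exp (φ (x * l))) :=
    ENNReal.continuous_ofReal.comp (by fun_prop)
  calc ∫⁻ ω, ENNReal.ofReal (Real.exp (l * ζ ω)) ∂μ
      = ∫⁻ ω, liminf (fun n => ENNReal.ofReal (Real.exp (l * ξ (ns n) ω))) atTop ∂μ := by
        refine lintegral_congr_ae ?_
        filter_upwards [hae] with ω hω
        exact ((hcont.tendsto _).comp hω).liminf_eq.symm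
    _ ≤ liminf (fun n => ∫⁻ ω, ENNReal.ofReal (Real.exp (l * ξ (ns n) ω)) ∂μ) atTop :=
        lintegral_liminf_le' fun n => (h (ns n)).aemeasurable_ofReal_exp l
    _ ≤ liminf (fun n => ENNReal.ofReal (Real.exp (φ (c (ns n) * l)))) atTop :=
        liminf_le_liminf (Eventually.of_forall fun n => (h (ns n)).le l)
    _ = ENNReal.ofReal (Real.exp (φ (a * l))) :=
        ((hcont'.tendsto _).comp (hc.comp hns.tendsto_atTop)).liminf_eq

theorem ae_eq_zero [IsProbabilityMeasure μ] (hφ : φ 0 = 0) (h : HasMGFBound φ μ ζ 0) :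
    ζ =ᵐ[μ] 0 := by
  have hint (l : ℝ) : ∫ ω, Real.exp (l * ζ ω) ∂μ ≤ 1 := by
    simpa [hφ] using ((hasMGFBound_iff.1 h).2 l).2
  have hcosh (ω : Ω) : Real.cosh (ζ ω) = (Real.exp (1 * ζ ω) + Real.exp (-1 * ζ ω)) / 2 := by
    rw [Real.cosh_eq, one_mul, neg_one_mul]
  have hcosh_int : Integrable (fun ω => Real.cosh (ζ ω)) μ := by
    simp_rw [hcosh]
    exact ((h.integrable_exp 1).add (h.integrable_exp (-1))).div_const 2
  have hcosh_le : ∫ ω, Real.cosh (ζ ω) ∂μ ≤ 1 := by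
    simp_rw [hcosh]
    rw [integral_div, integral_add (h.integrable_exp 1) (h.integrable_exp (-1))]
    linarith [hint 1, hint (-1)]
  have hnonneg (ω : Ω) : 0 ≤ Real.cosh (ζ ω) - 1 := sub_nonneg.2 (Real.one_le_cosh _)
  have hzero : ∫ ω, (Real.cosh (ζ ω) - 1) ∂μ = 0 := by
    refine le_antisymm ?_ (integral_nonneg hnonneg)
    rw [integral_sub hcosh_int (integrable_const 1)]
    simpa using hcosh_le
  have hae := (integral_eq_zero_iff_of_nonneg hnonneg (hcosh_int.sub (integrable_const 1))).1 hzero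
  filter_upwards [hae] with ω hω
  by_contra hne
  exact (Real.one_lt_cosh.2 hne).ne' (sub_eq_zero.1 hω)

end HasMGFBound

theorem IsPhiSubGaussian.exists_hasMGFBound (h : IsPhiSubGaussian φ μ ζ) :
    ∃ a : ℝ, 0 < a ∧ HasMGFBound φ μ ζ a := by
  obtain ⟨a, ha, hb⟩ := h.bound
  refine ⟨a, ha, hasMGFBound_iff.2 ⟨h.integrable.aemeasurable, fun l => ⟨h.integrable_exp l, ?_⟩⟩⟩
  exact mul_comm l a ▸ hb l

theorem IsPhiSubGaussian.memLp_two (h : IsPhiSubGaussian φ μ ζ) : MemLp ζ 2 μ := by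
  have : integrableExpSet ζ μ = univ := by
    ext l
    simpa [integrableExpSet] using h.integrable_exp l
  exact_mod_cast memLp_of_mem_interior_integrableExpSet (X := ζ) (μ := μ) (by simp [this]) 2

theorem exists_hasMGFBound_of_mem_span [IsProbabilityMeasure μ] (hφ : IsYoungFunction φ)
    {T : Type*} {y : T → Ω → ℝ} (hy : ∀ i, ∃ a : ℝ, 0 < a ∧ HasMGFBound φ μ (y i) a)
    (hζ : ζ ∈ Submodule.span ℝ (range y)) : ∃ a : ℝ, 0 < a ∧ HasMGFBound φ μ ζ a := by
  induction hζ using Submodule.span_induction with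
  | mem x hx =>
    obtain ⟨i, rfl⟩ := hx
    exact hy i
  | zero => exact ⟨1, one_pos, hasMGFBound_zero hφ 1⟩
  | add x z _ _ hx hz =>
    obtain ⟨a, ha, hx⟩ := hx
    obtain ⟨b, hb, hz⟩ := hz
    exact ⟨a + b, by positivity, hx.add hz ha hb⟩
  | smul c x _ hx =>
    obtain ⟨a, ha, hx⟩ := hx
    refine ⟨a * (|c| + 1), by positivity, (hx.const_mul c).mono hφ ?_⟩
    rw [abs_mul, abs_mul, abs_of_nonneg (by positivity : 0 ≤ |c| + 1)]
    gcongr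
    linarith

theorem memLp_of_mem_span {p : ℝ≥0∞} {T : Type*} {y : T → Ω → ℝ} (hy : ∀ i, MemLp (y i) p μ)
    (hζ : ζ ∈ Submodule.span ℝ (range y)) : MemLp ζ p μ := by
  induction hζ using Submodule.span_induction with
  | mem x hx =>
    obtain ⟨i, rfl⟩ := hx
    exact hy i
  | zero => exact MemLp.zero'
  | add x z _ _ hx hz => exact hx.add hz
  | smul c x _ hx => exact hx.const_smul c

theorem sqrt_integral_sq_eq_toReal_eLpNorm (h : MemLp ζ 2 μ) :
    √(∫ ω, ζ ω ^ 2 ∂μ) = (eLpNorm ζ 2 μ).toReal := by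
  rw [h.eLpNorm_eq_integral_rpow_norm two_ne_zero ENNReal.ofNat_ne_top,
    ENNReal.toReal_ofReal (by positivity), Real.sqrt_eq_rpow]
  simp

theorem tendsto_toReal_eLpNorm {ι : Type*} {l : Filter ι} {p : ℝ≥0∞} [Fact (1 ≤ p)]
    {ξ : ι → Ω → ℝ} (hξ : ∀ i, MemLp (ξ i) p μ) (hζ : MemLp ζ p μ)
    (h : Tendsto (fun i => eLpNorm (ξ i - ζ) p μ) l (𝓝 0)) :
    Tendsto (fun i => (eLpNorm (ξ i) p μ).toReal) l (𝓝 (eLpNorm ζ p μ).toReal) := by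
  simpa only [Lp.norm_toLp] using ((Lp.tendsto_Lp_iff_tendsto_eLpNorm'' ξ hξ ζ hζ).2 h).norm

theorem IsStrictlyPhiSubGaussian.hasMGFBound_of_mem_span [IsProbabilityMeasure μ]
    (hφ : IsYoungFunction φ) {T : Type*} {y : T → Ω → ℝ} {C : ℝ}
    (hy : IsStrictlyPhiSubGaussian φ μ y C) (hζ : ζ ∈ Submodule.span ℝ (range y)) :
    HasMGFBound φ μ ζ (C * (eLpNorm ζ 2 μ).toReal) := by
  obtain ⟨a, ha, h⟩ :=
    exists_hasMGFBound_of_mem_span hφ (fun i => (hy.mem i).exists_hasMGFBound) hζ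
  have hLp := memLp_of_mem_span (fun i => (hy.mem i).memLp_two) hζ
  refine (h.hasMGFBound_tau hφ.continuous ha).mono hφ (abs_le_abs_of_nonneg (tau_nonneg ζ) ?_)
  rw [← sqrt_integral_sq_eq_toReal_eLpNorm hLp]
  obtain ⟨c, rfl⟩ := Finsupp.mem_span_range_iff_exists_finsupp.1 hζ
  have hsum : (c.sum fun i a => a • y i) = fun ω => ∑ i ∈ c.support, c i * y i ω := by
    ext ω
    simp [Finsupp.sum]
  simpa only [hsum] using hy.le c.support c

end MGFBound

section TaggedGrid

variable {Ω : Type*} {A B : ℝ} (P : TaggedGrid A B) (f g : ℝ → ℝ) (y : ℝ → Ω → ℝ)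

namespace TaggedGrid

theorem sum_sub (ω : Ω) : P.sum (fun l => f l - g l) y ω = P.sum f y ω - P.sum g y ω := by
  simp only [TaggedGrid.sum, ← Finset.sum_sub_distrib, sub_mul]

theorem sum_mem_span : P.sum f y ∈ Submodule.span ℝ (range y) := by
  have : P.sum f y = ∑ i ∈ Finset.range P.n, f (P.tag i) • (y (P.pt (i + 1)) - y (P.pt i)) := by
    ext ω
    simp [TaggedGrid.sum]
  rw [this]
  exact Submodule.sum_mem _ fun i _ => Submodule.smul_mem _ _ (Submodule.sub_mem _
    (Submodule.subset_span (mem_range_self _)) (Submodule.subset_span (mem_range_self _)))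

theorem sum_sq (ω : Ω) : P.sum f y ω ^ 2 = ∑ i ∈ Finset.range P.n, ∑ j ∈ Finset.range P.n,
    f (P.tag i) * f (P.tag j) *
      ((y (P.pt (i + 1)) ω - y (P.pt i) ω) * (y (P.pt (j + 1)) ω - y (P.pt j) ω)) := by
  rw [sq, TaggedGrid.sum, Finset.sum_mul_sum]
  exact Finset.sum_congr rfl fun i _ => Finset.sum_congr rfl fun j _ => mul_mul_mul_comm _ _ _ _

theorem exists_meshLE_isMinOn {δ : ℝ} (hAB : A < B) (hδ : 0 < δ) {w : ℝ → ℝ}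
    (hw : Continuous w) : ∃ P : TaggedGrid A B, P.MeshLE δ ∧
      ∀ i, IsMinOn w (Icc (P.pt i) (P.pt (i + 1))) (P.tag i) := by
  obtain ⟨n, hn⟩ := exists_nat_gt ((B - A) / δ)
  have hn_pos : (0 : ℝ) < n := (div_pos (sub_pos.2 hAB) hδ).trans hn
  have hstep : (B - A) / n ≤ δ := (div_lt_comm₀ hδ hn_pos).1 hn |>.le
  have : 0 ≤ (B - A) / n := div_nonneg (sub_pos.2 hAB).le hn_pos.le
  set pt : ℕ → ℝ := fun i => A + i * ((B - A) / n) with hpt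
  have hmono : Monotone pt := fun i j hij => by simp only [hpt]; gcongr
  have hmin (i : ℕ) : ∃ t ∈ Icc (pt i) (pt (i + 1)), IsMinOn w (Icc (pt i) (pt (i + 1))) t :=
    isCompact_Icc.exists_isMinOn (nonempty_Icc.2 (hmono i.le_succ)) hw.continuousOn
  choose tag htag hmin using hmin
  refine ⟨⟨n, pt, tag, hmono, by simp [hpt], ?_, fun i _ => htag i⟩, fun i _ => ?_, hmin⟩
  · simp only [hpt]
    field_simp
    ring
  · simp only [hpt]
    push_cast
    linarith

end TaggedGrid

end TaggedGrid

section MeanSquareIntegral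

variable {Ω : Type*} [MeasurableSpace Ω] {μ : Measure Ω} {φ f g w : ℝ → ℝ} {y : ℝ → Ω → ℝ}
  {A B : ℝ} {X Y : Ω → ℝ}

theorem IsMSIntegralOn.sub (hy : ∀ i, MemLp (y i) 2 μ) (hX : IsMSIntegralOn μ f y A B X)
    (hY : IsMSIntegralOn μ g y A B Y) :
    IsMSIntegralOn μ (fun l => f l - g l) y A B (fun ω => X ω - Y ω) := by
  refine ⟨hX.1.sub hY.1, fun ε hε => ?_⟩
  obtain ⟨δ₁, hδ₁, hX_le⟩ := hX.2 (ε / 2) (by positivity)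
  obtain ⟨δ₂, hδ₂, hY_le⟩ := hY.2 (ε / 2) (by positivity)
  refine ⟨min δ₁ δ₂, lt_min hδ₁ hδ₂, fun P hP => ?_⟩
  have hsum (f : ℝ → ℝ) : MemLp (P.sum f y) 2 μ := memLp_of_mem_span hy (P.sum_mem_span f y)
  calc eLpNorm (fun ω => P.sum (fun l => f l - g l) y ω - (X ω - Y ω)) 2 μ
      = eLpNorm ((fun ω => P.sum f y ω - X ω) - (fun ω => P.sum g y ω - Y ω)) 2 μ := by
        simp only [P.sum_sub, sub_sub_sub_comm, Pi.sub_def]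
    _ ≤ eLpNorm (fun ω => P.sum f y ω - X ω) 2 μ + eLpNorm (fun ω => P.sum g y ω - Y ω) 2 μ :=
        eLpNorm_sub_le ((hsum f).sub hX.1).1 ((hsum g).sub hY.1).1 (by norm_num)
    _ ≤ ENNReal.ofReal (ε / 2) + ENNReal.ofReal (ε / 2) :=
        add_le_add (hX_le P fun i hi => (hP i hi).trans (min_le_left _ _))
          (hY_le P fun i hi => (hP i hi).trans (min_le_right _ _))
    _ = ENNReal.ofReal ε := by rw [← ENNReal.ofReal_add (by positivity) (by positivity), add_halves]

theorem eventually_fst_lt_snd_atBot_prod_atTop :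
    ∀ᶠ p : ℝ × ℝ in atBot ×ˢ atTop, p.1 < p.2 := by
  filter_upwards [(eventually_lt_atBot (0 : ℝ)).prod_mk (eventually_gt_atTop (0 : ℝ))] with p hp
  exact hp.1.trans hp.2

theorem IsMSIntegral.sub (hy : ∀ i, MemLp (y i) 2 μ) (hX : IsMSIntegral μ f y X)
    (hY : IsMSIntegral μ g y Y) :
    IsMSIntegral μ (fun l => f l - g l) y (fun ω => X ω - Y ω) := by
  obtain ⟨hX_memLp, J, hJ, hJ_lim⟩ := hX
  obtain ⟨hY_memLp, K, hK, hK_lim⟩ := hY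
  refine ⟨hX_memLp.sub hY_memLp, fun A B ω => J A B ω - K A B ω,
    fun A B h => (hJ A B h).sub hy (hK A B h), ?_⟩
  refine tendsto_of_tendsto_of_tendsto_of_le_of_le' tendsto_const_nhds
    (by simpa using hJ_lim.add hK_lim) (Eventually.of_forall fun _ => zero_le) ?_
  filter_upwards [eventually_fst_lt_snd_atBot_prod_atTop] with p hp
  calc eLpNorm (fun ω => J p.1 p.2 ω - K p.1 p.2 ω - (X ω - Y ω)) 2 μ
      = eLpNorm ((fun ω => J p.1 p.2 ω - X ω) - (fun ω => K p.1 p.2 ω - Y ω)) 2 μ := by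
        simp only [sub_sub_sub_comm, Pi.sub_def]
    _ ≤ _ := eLpNorm_sub_le ((hJ _ _ hp).1.sub hX_memLp).1 ((hK _ _ hp).1.sub hY_memLp).1
        (by norm_num)

theorem IsMSIntegral.exists_eLpNorm_sum_sub_le (hy : ∀ i, MemLp (y i) 2 μ)
    (hX : IsMSIntegral μ f y X) (hw : Continuous w) {ε : ℝ} (hε : 0 < ε) :
    ∃ (A B : ℝ) (P : TaggedGrid A B),
      (∀ i, IsMinOn w (Icc (P.pt i) (P.pt (i + 1))) (P.tag i)) ∧
      eLpNorm (P.sum f y - X) 2 μ ≤ ENNReal.ofReal ε := by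
  obtain ⟨hX_memLp, J, hJ, hJ_lim⟩ := hX
  have hlt := hJ_lim.eventually_lt_const (u := ENNReal.ofReal (ε / 2)) (by simpa using hε)
  obtain ⟨p, hp, hlt⟩ := (eventually_fst_lt_snd_atBot_prod_atTop.and hlt).exists
  obtain ⟨δ, hδ, hJ_le⟩ := (hJ p.1 p.2 hp).2 (ε / 2) (by positivity)
  obtain ⟨P, hmesh, hmin⟩ := TaggedGrid.exists_meshLE_isMinOn hp hδ hw
  refine ⟨p.1, p.2, P, hmin, ?_⟩
  have hsum : MemLp (P.sum f y) 2 μ := memLp_of_mem_span hy (P.sum_mem_span f y)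
  have hJ_memLp := (hJ p.1 p.2 hp).1
  calc eLpNorm (P.sum f y - X) 2 μ
      = eLpNorm ((fun ω => P.sum f y ω - J p.1 p.2 ω) + (fun ω => J p.1 p.2 ω - X ω)) 2 μ := by
        simp only [Pi.add_def, Pi.sub_def, sub_add_sub_cancel]
    _ ≤ _ := eLpNorm_add_le (hsum.sub hJ_memLp).1 (hJ_memLp.sub hX_memLp).1 (by norm_num)
    _ ≤ ENNReal.ofReal (ε / 2) + ENNReal.ofReal (ε / 2) := add_le_add (hJ_le P hmesh) hlt.le
    _ = ENNReal.ofReal ε := by rw [← ENNReal.ofReal_add (by positivity) (by positivity), add_halves]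

theorem IsMSIntegral.exists_seq_tendsto_eLpNorm (hy : ∀ i, MemLp (y i) 2 μ)
    (hX : IsMSIntegral μ f y X) (hw : Continuous w) :
    ∃ (A B : ℕ → ℝ) (P : ∀ n, TaggedGrid (A n) (B n)),
      (∀ n i, IsMinOn w (Icc ((P n).pt i) ((P n).pt (i + 1))) ((P n).tag i)) ∧
      Tendsto (fun n => eLpNorm ((P n).sum f y - X) 2 μ) atTop (𝓝 0) := by
  choose A B P hmin hle using fun n : ℕ =>
    hX.exists_eLpNorm_sum_sub_le hy hw (Nat.one_div_pos_of_nat (α := ℝ) (n := n))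
  refine ⟨A, B, P, hmin, tendsto_of_tendsto_of_tendsto_of_le_of_le tendsto_const_nhds ?_
    (fun _ => zero_le) hle⟩
  simpa only [Function.comp_def, ENNReal.ofReal_zero] using
    (ENNReal.continuous_ofReal.tendsto 0).comp (tendsto_one_div_add_atTop_nhds_zero_nat (𝕜 := ℝ))

theorem IsMSIntegral.hasMGFBound [IsProbabilityMeasure μ] (hφ : IsYoungFunction φ) {C : ℝ}
    (hy : IsStrictlyPhiSubGaussian φ μ y C) (hX : IsMSIntegral μ f y X) :
    HasMGFBound φ μ X (C * (eLpNorm X 2 μ).toReal) := by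
  have hy_memLp := fun i => (hy.mem i).memLp_two
  obtain ⟨A, B, P, -, hlim⟩ := hX.exists_seq_tendsto_eLpNorm hy_memLp (w := 0) continuous_const
  have hsum (n : ℕ) : MemLp ((P n).sum f y) 2 μ :=
    memLp_of_mem_span hy_memLp ((P n).sum_mem_span f y)
  exact .of_tendstoInMeasure hφ.continuous
    (fun n => hy.hasMGFBound_of_mem_span hφ ((P n).sum_mem_span f y))
    ((tendsto_toReal_eLpNorm hsum hX.1 hlim).const_mul C)
    (tendstoInMeasure_of_tendsto_eLpNorm two_ne_zero (fun n => (hsum n).1) hX.1.1 hlim)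

theorem integral_increment_mul_increment (hy : ∀ i, MemLp (y i) 2 μ) (s s' t t' : ℝ) :
    ∫ ω, (y s' ω - y s ω) * (y t' ω - y t ω) ∂μ = rectIncr (covFun μ y) s s' t t' := by
  have hint (s t : ℝ) : Integrable (fun ω => y s ω * y t ω) μ := (hy s).integrable_mul (hy t)
  have hexpand (ω : Ω) : (y s' ω - y s ω) * (y t' ω - y t ω) =
      y s' ω * y t' ω - y s ω * y t' ω - y s' ω * y t ω + y s ω * y t ω := by ring
  simp_rw [hexpand]
  have hsub : Integrable (fun ω => y s' ω * y t' ω - y s ω * y t' ω) μ :=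
    (hint _ _).sub (hint _ _)
  have hsub_sub : Integrable (fun ω => y s' ω * y t' ω - y s ω * y t' ω - y s' ω * y t ω) μ :=
    hsub.sub (hint _ _)
  rw [integral_add hsub_sub (hint _ _), integral_sub hsub (hint _ _),
    integral_sub (hint _ _) (hint _ _)]
  rfl

/-- The `L²` norm of `w` with respect to the variation of `G`. It is `0` if the variation
integral is infinite. -/
noncomputable def variationNorm (G : ℝ → ℝ → ℝ) (w : ℝ → ℝ) : ℝ :=
  √(varIntegral G (fun s t => ENNReal.ofReal (w s * w t))).toReal

namespace TaggedGrid

variable (P : TaggedGrid A B)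

theorem integral_sum_sq (f : ℝ → ℝ) (hy : ∀ i, MemLp (y i) 2 μ) :
    ∫ ω, P.sum f y ω ^ 2 ∂μ = ∑ i ∈ Finset.range P.n, ∑ j ∈ Finset.range P.n,
      f (P.tag i) * f (P.tag j) *
        rectIncr (covFun μ y) (P.pt i) (P.pt (i + 1)) (P.pt j) (P.pt (j + 1)) := by
  have hincr (i : ℕ) : MemLp (fun ω => y (P.pt (i + 1)) ω - y (P.pt i) ω) 2 μ :=
    (hy _).sub (hy _)
  have hint (i j : ℕ) : Integrable (fun ω => f (P.tag i) * f (P.tag j) *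
      ((y (P.pt (i + 1)) ω - y (P.pt i) ω) * (y (P.pt (j + 1)) ω - y (P.pt j) ω))) μ :=
    ((hincr i).integrable_mul (hincr j)).const_mul _
  simp_rw [P.sum_sq]
  rw [integral_finsetSum _ fun i _ => integrable_finsetSum _ fun j _ => hint i j]
  refine Finset.sum_congr rfl fun i _ => ?_
  rw [integral_finsetSum _ fun j _ => hint i j]
  refine Finset.sum_congr rfl fun j _ => ?_
  rw [integral_const_mul, integral_increment_mul_increment hy]

theorem sum_abs_rectIncr_le_varIntegral (G : ℝ → ℝ → ℝ) (hw : ∀ s, 0 ≤ w s)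
    (hP : ∀ i, IsMinOn w (Icc (P.pt i) (P.pt (i + 1))) (P.tag i)) :
    ENNReal.ofReal (∑ i ∈ Finset.range P.n, ∑ j ∈ Finset.range P.n, w (P.tag i) * w (P.tag j) *
        |rectIncr G (P.pt i) (P.pt (i + 1)) (P.pt j) (P.pt (j + 1))|) ≤
      varIntegral G (fun s t => ENNReal.ofReal (w s * w t)) := by
  have hterm (i j : ℕ) : 0 ≤ w (P.tag i) * w (P.tag j) *
      |rectIncr G (P.pt i) (P.pt (i + 1)) (P.pt j) (P.pt (j + 1))| :=
    mul_nonneg (mul_nonneg (hw _) (hw _)) (abs_nonneg _)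
  refine le_trans ?_ (le_iSup_of_le P.n <| le_iSup_of_le P.n <| le_iSup_of_le P.pt <|
    le_iSup_of_le P.pt <| le_iSup_of_le P.mono <| le_iSup_of_le P.mono le_rfl)
  rw [ENNReal.ofReal_sum_of_nonneg fun i _ => Finset.sum_nonneg fun j _ => hterm i j]
  refine Finset.sum_le_sum fun i _ => ?_
  rw [ENNReal.ofReal_sum_of_nonneg fun j _ => hterm i j]
  refine Finset.sum_le_sum fun j _ => ?_
  rw [ENNReal.ofReal_mul (mul_nonneg (hw _) (hw _))]
  gcongr
  exact le_iInf₂ fun s hs => le_iInf₂ fun t ht =>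
    ENNReal.ofReal_le_ofReal (mul_le_mul (hP i hs) (hP j ht) (hw _) (hw _))

theorem toReal_eLpNorm_sum_le {M : ℝ} (hy : ∀ i, MemLp (y i) 2 μ) (hw : ∀ s, 0 ≤ w s)
    (hM : 0 ≤ M) (hf : ∀ s, |f s| ≤ M * w s)
    (hfin : varIntegral (covFun μ y) (fun s t => ENNReal.ofReal (w s * w t)) < ∞)
    (hP : ∀ i, IsMinOn w (Icc (P.pt i) (P.pt (i + 1))) (P.tag i)) :
    (eLpNorm (P.sum f y) 2 μ).toReal ≤ M * variationNorm (covFun μ y) w := by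
  rw [← sqrt_integral_sq_eq_toReal_eLpNorm (memLp_of_mem_span hy (P.sum_mem_span f y)),
    P.integral_sum_sq f hy, variationNorm, ← Real.sqrt_sq hM, ← Real.sqrt_mul (sq_nonneg M)]
  refine Real.sqrt_le_sqrt (le_trans ?_ (mul_le_mul_of_nonneg_left
    ((ENNReal.ofReal_le_iff_le_toReal hfin.ne).1
      (P.sum_abs_rectIncr_le_varIntegral (covFun μ y) hw hP)) (sq_nonneg M)))
  simp_rw [Finset.mul_sum]
  refine Finset.sum_le_sum fun i _ => Finset.sum_le_sum fun j _ => ?_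
  calc f (P.tag i) * f (P.tag j) * rectIncr (covFun μ y) _ _ _ _
      ≤ |f (P.tag i)| * |f (P.tag j)| * |rectIncr (covFun μ y) _ _ _ _| := by
        rw [← abs_mul, ← abs_mul]
        exact le_abs_self _
    _ ≤ M * w (P.tag i) * (M * w (P.tag j)) * |rectIncr (covFun μ y) _ _ _ _| := by
        gcongr
        · exact mul_nonneg hM (hw _)
        · exact hf _
        · exact hf _
    _ = M ^ 2 * (w (P.tag i) * w (P.tag j) * |rectIncr (covFun μ y) _ _ _ _|) := by ring

end TaggedGrid

theorem IsMSIntegral.toReal_eLpNorm_le {M : ℝ} (hy : ∀ i, MemLp (y i) 2 μ)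
    (hX : IsMSIntegral μ f y X) (hw_cont : Continuous w) (hw : ∀ s, 0 ≤ w s) (hM : 0 ≤ M)
    (hf : ∀ s, |f s| ≤ M * w s)
    (hfin : varIntegral (covFun μ y) (fun s t => ENNReal.ofReal (w s * w t)) < ∞) :
    (eLpNorm X 2 μ).toReal ≤ M * variationNorm (covFun μ y) w := by
  obtain ⟨A, B, P, hmin, hlim⟩ := hX.exists_seq_tendsto_eLpNorm hy hw_cont
  have hsum (n : ℕ) : MemLp ((P n).sum f y) 2 μ := memLp_of_mem_span hy ((P n).sum_mem_span f y)
  exact le_of_tendsto' (tendsto_toReal_eLpNorm hsum hX.1 hlim) fun n =>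
    (P n).toReal_eLpNorm_sum_le hy hw hM hf hfin (hmin n)

end MeanSquareIntegral

section DispersiveField

/-- The conditions on an admissible function `Z` with constant `u₀` that do not involve `φ`: they
make `σ h = 2 C / Z (1 / h + u₀)` a modulus of continuity in mean square. -/
structure IsScaleFunction (Z : ℝ → ℝ) (u₀ : ℝ) : Prop where
  u₀_nonneg : 0 ≤ u₀
  continuousOn : ContinuousOn Z (Ici 0)
  strictMonoOn : StrictMonoOn Z (Ici 0)
  pos : ∀ u, 0 < u → 0 < Z u
  ratio_mono : MonotoneOn (fun u => u / Z u) (Ioi u₀)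
  tendsto_top : Tendsto Z atTop atTop

theorem IsAdmissible.isScaleFunction {φ Z : ℝ → ℝ} {u₀ : ℝ} (hZ : IsAdmissible φ Z u₀) :
    IsScaleFunction Z u₀ :=
  ⟨hZ.u₀_nonneg, hZ.continuousOn, hZ.strictMonoOn, hZ.pos, hZ.ratio_mono, hZ.tendsto_top⟩

/-- The weight `w λ = Z (|λ| / 2 + u₀) + Z (|ψ λ| / 2 + u₀)` that controls the increments of the
phase `λ x + t ψ λ`, for a general dispersion symbol `ψ`. -/
noncomputable def phaseWeight (Z : ℝ → ℝ) (u₀ : ℝ) (ψ : ℝ → ℝ) (l : ℝ) : ℝ :=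
  Z (|l| / 2 + u₀) + Z (1 / 2 * |ψ l| + u₀)

/-- `κ` is `1`-Lipschitz for the distance `|exp (i x) - exp (i y)| = 2 |sin ((x - y) / 2)|`, as the
cosine and the sine are. -/
def IsChordLipschitz (κ : ℝ → ℝ) : Prop := ∀ x y, |κ x - κ y| ≤ 2 * |Real.sin ((x - y) / 2)|

theorem isChordLipschitz_cos : IsChordLipschitz Real.cos := fun x y => by
  rw [Real.cos_sub_cos, abs_mul, abs_mul, abs_neg, abs_two, mul_right_comm]
  exact mul_le_of_le_one_right (by positivity) (Real.abs_sin_le_one _)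

theorem isChordLipschitz_sin : IsChordLipschitz Real.sin := fun x y => by
  rw [Real.sin_sub_sin, abs_mul, abs_mul, abs_two]
  exact mul_le_of_le_one_right (by positivity) (Real.abs_cos_le_one _)

theorem abs_sin_add_le (x y : ℝ) : |Real.sin (x + y)| ≤ |Real.sin x| + |Real.sin y| := by
  rw [Real.sin_add]
  refine (abs_add_le _ _).trans (add_le_add ?_ ?_) <;> rw [abs_mul]
  · exact mul_le_of_le_one_right (abs_nonneg _) (Real.abs_cos_le_one _)
  · exact mul_le_of_le_one_left (abs_nonneg _) (Real.abs_cos_le_one _)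

theorem continuous_symb (N : ℕ) (a : ℕ → ℝ) : Continuous (symb N a) := by
  unfold symb
  fun_prop

namespace IsScaleFunction

variable {Z : ℝ → ℝ} {u₀ : ℝ} (hZ : IsScaleFunction Z u₀)
include hZ

theorem nonneg {u : ℝ} (hu : 0 ≤ u) : 0 ≤ Z u := by
  have hlim : Tendsto Z (𝓝[>] 0) (𝓝 (Z 0)) :=
    (hZ.continuousOn 0 self_mem_Ici).mono Ioi_subset_Ici_self
  have hzero : 0 ≤ Z 0 := ge_of_tendsto hlim (by
    filter_upwards [self_mem_nhdsWithin] with x hx using (hZ.pos x hx).le)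
  exact hzero.trans (hZ.strictMonoOn.monotoneOn self_mem_Ici hu hu)

theorem continuous_phaseWeight {ψ : ℝ → ℝ} (hψ : Continuous ψ) :
    Continuous (phaseWeight Z u₀ ψ) := by
  have := hZ.u₀_nonneg
  refine (hZ.continuousOn.comp_continuous (by fun_prop) fun l => ?_).add
    (hZ.continuousOn.comp_continuous (by fun_prop) fun l => ?_) <;>
  exact add_nonneg (by positivity) this

theorem phaseWeight_nonneg (ψ : ℝ → ℝ) (l : ℝ) : 0 ≤ phaseWeight Z u₀ ψ l := by
  have := hZ.u₀_nonneg
  exact add_nonneg (hZ.nonneg (by positivity)) (hZ.nonneg (by positivity))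

theorem div_le_div {x y : ℝ} (hx : 0 < x) (hxy : x ≤ y) : x / y ≤ Z (x + u₀) / Z (y + u₀) := by
  have hu₀ := hZ.u₀_nonneg
  have hy : 0 < y := hx.trans_le hxy
  have hratio : (x + u₀) / Z (x + u₀) ≤ (y + u₀) / Z (y + u₀) :=
    hZ.ratio_mono (mem_Ioi.2 (by linarith)) (mem_Ioi.2 (by linarith)) (by linarith)
  calc x / y ≤ (x + u₀) / (y + u₀) := by
        rw [div_le_div_iff₀ hy (by positivity)]
        nlinarith
    _ ≤ Z (x + u₀) / Z (y + u₀) := by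
        rw [div_le_div_iff₀ (hZ.pos _ (by positivity)) (hZ.pos _ (by positivity))] at hratio
        rw [div_le_div_iff₀ (by positivity) (hZ.pos _ (by positivity))]
        linarith

theorem abs_sin_le {h l s : ℝ} (hh : 0 < h) (hs : |s| ≤ h) :
    |Real.sin (l * s / 2)| ≤ Z (|l| / 2 + u₀) / Z (1 / h + u₀) := by
  have hu₀ := hZ.u₀_nonneg
  have hpos : 0 < Z (1 / h + u₀) := hZ.pos _ (by positivity)
  rcases le_or_gt (1 / h) (|l| / 2) with hl | hl
  · refine (Real.abs_sin_le_one _).trans ((one_le_div hpos).2 ?_)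
    exact hZ.strictMonoOn.monotoneOn (mem_Ici.2 (by positivity)) (mem_Ici.2 (by positivity))
      (by linarith)
  rcases eq_or_ne l 0 with rfl | hl_ne
  · simpa using div_nonneg (hZ.nonneg hu₀) hpos.le
  calc |Real.sin (l * s / 2)| ≤ |l * s / 2| := Real.abs_sin_le_abs
    _ ≤ (|l| / 2) / (1 / h) := by
        rw [abs_div, abs_mul, abs_two, div_div_eq_mul_div, div_one, div_mul_eq_mul_div]
        gcongr
    _ ≤ Z (|l| / 2 + u₀) / Z (1 / h + u₀) := hZ.div_le_div (by positivity) hl.le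

theorem abs_kernel_sub_le {κ ψ : ℝ → ℝ} (hκ : IsChordLipschitz κ) {t t' x x' h : ℝ} (hh : 0 < h)
    (ht : |t - t'| ≤ h) (hx : |x - x'| ≤ h) (l : ℝ) :
    |κ (l * x + t * ψ l) - κ (l * x' + t' * ψ l)| ≤
      2 / Z (1 / h + u₀) * phaseWeight Z u₀ ψ l := by
  have hphase : (l * x + t * ψ l - (l * x' + t' * ψ l)) / 2 =
      l * (x - x') / 2 + ψ l * (t - t') / 2 := by ring
  calc |κ (l * x + t * ψ l) - κ (l * x' + t' * ψ l)|
      ≤ 2 * |Real.sin (l * (x - x') / 2 + ψ l * (t - t') / 2)| := hphase ▸ hκ _ _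
    _ ≤ 2 * (|Real.sin (l * (x - x') / 2)| + |Real.sin (ψ l * (t - t') / 2)|) := by
        gcongr
        exact abs_sin_add_le _ _
    _ ≤ 2 * (Z (|l| / 2 + u₀) / Z (1 / h + u₀) + Z (|ψ l| / 2 + u₀) / Z (1 / h + u₀)) := by
        gcongr
        · exact hZ.abs_sin_le hh hx
        · exact hZ.abs_sin_le hh ht
    _ = 2 / Z (1 / h + u₀) * phaseWeight Z u₀ ψ l := by
        rw [phaseWeight, one_div_mul_eq_div]
        ring

theorem hasMGFBound_sub {Ω : Type*} [MeasurableSpace Ω] {μ : Measure Ω} [IsProbabilityMeasure μ]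
    {φ κ ψ : ℝ → ℝ} (hφ : IsYoungFunction φ) {y : ℝ → Ω → ℝ} {C : ℝ}
    (hy : IsStrictlyPhiSubGaussian φ μ y C) (hκ : IsChordLipschitz κ) (hψ : Continuous ψ)
    (hfin : varIntegral (covFun μ y)
      (fun l m => ENNReal.ofReal (phaseWeight Z u₀ ψ l * phaseWeight Z u₀ ψ m)) < ∞)
    {t t' x x' h : ℝ} {X X' : Ω → ℝ} (hh : 0 < h) (ht : |t - t'| ≤ h) (hx : |x - x'| ≤ h)
    (hX : IsMSIntegral μ (fun l => κ (l * x + t * ψ l)) y X)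
    (hX' : IsMSIntegral μ (fun l => κ (l * x' + t' * ψ l)) y X') :
    HasMGFBound φ μ (fun ω => X ω - X' ω)
      (sigma Z u₀ (C * variationNorm (covFun μ y) (phaseWeight Z u₀ ψ)) h) := by
  have hu₀ := hZ.u₀_nonneg
  have hy_memLp := fun i => (hy.mem i).memLp_two
  have hsub := hX.sub hy_memLp hX'
  refine (hsub.hasMGFBound hφ hy).mono hφ
    (abs_le_abs_of_nonneg (mul_nonneg hy.nonneg ENNReal.toReal_nonneg) ?_)
  calc C * (eLpNorm (fun ω => X ω - X' ω) 2 μ).toReal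
      ≤ C * (2 / Z (1 / h + u₀) * variationNorm (covFun μ y) (phaseWeight Z u₀ ψ)) :=
        mul_le_mul_of_nonneg_left (hsub.toReal_eLpNorm_le hy_memLp (hZ.continuous_phaseWeight hψ)
          (hZ.phaseWeight_nonneg ψ) (div_nonneg zero_le_two (hZ.nonneg (by positivity)))
          (hZ.abs_kernel_sub_le hκ hh ht hx) hfin) hy.nonneg
    _ = sigma Z u₀ (C * variationNorm (covFun μ y) (phaseWeight Z u₀ ψ)) h := by
        rw [sigma]
        ring

end IsScaleFunction

end DispersiveField

section ExpEnvelope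

variable {Ω T : Type*} [MeasurableSpace Ω] {μ : Measure Ω} {φ : ℝ → ℝ}

/-- The sum of the exponentials of `± c * Y q` over `q ∈ S`, which dominates the exponential of
`c * |Y q|` for each `q ∈ S`. Its integral stands in for the exponential moment of the maximum of
`|Y q|` over `q ∈ S`. -/
noncomputable def expEnvelope (S : Finset T) (Y : T → Ω → ℝ) (c : ℝ) (ω : Ω) : ℝ≥0∞ :=
  ∑ q ∈ S, (ENNReal.ofReal (Real.exp (c * Y q ω)) + ENNReal.ofReal (Real.exp (-c * Y q ω)))

variable {S : Finset T} {Y : T → Ω → ℝ} {a B : ℝ}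

omit [MeasurableSpace Ω] in
theorem ofReal_exp_mul_abs_le_expEnvelope (Y : T → Ω → ℝ) (c : ℝ) {q : T} (hq : q ∈ S) (ω : Ω) :
    ENNReal.ofReal (Real.exp (c * |Y q ω|)) ≤ expEnvelope S Y c ω := by
  refine le_trans ?_ (Finset.single_le_sum (fun _ _ => zero_le) hq)
  rcases abs_choice (Y q ω) with h | h <;> rw [h]
  · exact le_self_add
  · rw [mul_neg, ← neg_mul]
    exact le_add_self

theorem aemeasurable_expEnvelope (hY : ∀ q ∈ S, HasMGFBound φ μ (Y q) a) (c : ℝ) :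
    AEMeasurable (expEnvelope S Y c) μ :=
  Finset.aemeasurable_fun_sum S fun q hq =>
    ((hY q hq).aemeasurable_ofReal_exp c).add ((hY q hq).aemeasurable_ofReal_exp (-c))

theorem lintegral_expEnvelope_le (hφ : Function.Even φ) (hY : ∀ q ∈ S, HasMGFBound φ μ (Y q) a)
    {c : ℝ} (hB : φ (a * c) ≤ B) :
    ∫⁻ ω, expEnvelope S Y c ω ∂μ ≤ ENNReal.ofReal (2 * Real.exp B * S.card) := by
  have hB_neg : φ (a * -c) ≤ B := by rwa [mul_neg, hφ]
  have hmeas (q : T) (hq : q ∈ S) := (hY q hq).aemeasurable_ofReal_exp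
  calc ∫⁻ ω, expEnvelope S Y c ω ∂μ
      = ∑ q ∈ S, ∫⁻ ω, (ENNReal.ofReal (Real.exp (c * Y q ω)) +
          ENNReal.ofReal (Real.exp (-c * Y q ω))) ∂μ :=
        lintegral_finsetSum' S fun q hq => (hmeas q hq c).add (hmeas q hq (-c))
    _ ≤ ∑ q ∈ S, ENNReal.ofReal (2 * Real.exp B) := by
        refine Finset.sum_le_sum fun q hq => ?_
        rw [lintegral_add_left' (hmeas q hq c), two_mul,
          ENNReal.ofReal_add (Real.exp_pos _).le (Real.exp_pos _).le]
        exact add_le_add (((hY q hq).le c).trans (by gcongr))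
          (((hY q hq).le (-c)).trans (by gcongr))
    _ = _ := by
        rw [Finset.sum_const, nsmul_eq_mul, mul_comm, ENNReal.ofReal_mul' S.card.cast_nonneg,
          ENNReal.ofReal_natCast]

variable {ι : Type*} {s : Finset ι} {w : ι → ℝ}

omit [MeasurableSpace Ω] in
theorem ofReal_exp_mul_abs_sum_le_prod_expEnvelope (hw : ∀ k ∈ s, 0 < w k) {l : ℝ} (hl : 0 ≤ l)
    {S : ι → Finset T} (Y : ι → T → Ω → ℝ) {j : ι → T} (hj : ∀ k ∈ s, j k ∈ S k) (ω : Ω) :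
    ENNReal.ofReal (Real.exp (l * |∑ k ∈ s, Y k (j k) ω|)) ≤
      ∏ k ∈ s, expEnvelope (S k) (Y k) (l / w k) ω ^ w k := by
  calc ENNReal.ofReal (Real.exp (l * |∑ k ∈ s, Y k (j k) ω|))
      ≤ ENNReal.ofReal (Real.exp (∑ k ∈ s, l * |Y k (j k) ω|)) := by
        rw [← Finset.mul_sum]
        gcongr
        exact Finset.abs_sum_le_sum_abs _ _
    _ = ∏ k ∈ s, ENNReal.ofReal (Real.exp (l * |Y k (j k) ω|)) := by
        rw [Real.exp_sum, ENNReal.ofReal_prod_of_nonneg fun _ _ => (Real.exp_pos _).le]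
    _ = ∏ k ∈ s, ENNReal.ofReal (Real.exp (l / w k * |Y k (j k) ω|)) ^ w k := by
        refine Finset.prod_congr rfl fun k hk => ?_
        have := hw k hk
        rw [ENNReal.ofReal_rpow_of_pos (Real.exp_pos _), ← Real.exp_mul]
        field_simp
    _ ≤ _ := Finset.prod_le_prod' fun k hk => ENNReal.rpow_le_rpow
        (ofReal_exp_mul_abs_le_expEnvelope (Y k) _ (hj k hk) ω) (hw k hk).le

variable {S : ι → Finset T} {Y : ι → T → Ω → ℝ} {e : ι → ℝ} {l : ℝ}

theorem lintegral_prod_expEnvelope_le (hφ : Function.Even φ) (hw : ∀ k ∈ s, 0 < w k)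
    (hw_sum : ∑ k ∈ s, w k = 1) (hY : ∀ k ∈ s, ∀ q ∈ S k, HasMGFBound φ μ (Y k q) (e k))
    (hB : ∀ k ∈ s, φ (e k * (l / w k)) ≤ B) :
    ∫⁻ ω, ∏ k ∈ s, expEnvelope (S k) (Y k) (l / w k) ω ^ w k ∂μ ≤
      ENNReal.ofReal (2 * Real.exp B * ∏ k ∈ s, ((S k).card : ℝ) ^ w k) := by
  calc _ ≤ ∏ k ∈ s, (∫⁻ ω, expEnvelope (S k) (Y k) (l / w k) ω ∂μ) ^ w k :=
        ENNReal.lintegral_prod_norm_pow_le s (fun k hk => aemeasurable_expEnvelope (hY k hk) _)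
          hw_sum fun k hk => (hw k hk).le
    _ ≤ ∏ k ∈ s, ENNReal.ofReal (2 * Real.exp B * (S k).card) ^ w k :=
        Finset.prod_le_prod' fun k hk => ENNReal.rpow_le_rpow
          (lintegral_expEnvelope_le hφ (hY k hk) (hB k hk)) (hw k hk).le
    _ = ENNReal.ofReal (∏ k ∈ s, (2 * Real.exp B) ^ w k * ((S k).card : ℝ) ^ w k) := by
        rw [ENNReal.ofReal_prod_of_nonneg fun _ _ => by positivity]
        refine Finset.prod_congr rfl fun k hk => ?_
        rw [ENNReal.ofReal_rpow_of_nonneg (by positivity) (hw k hk).le,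
          Real.mul_rpow (by positivity) (Nat.cast_nonneg _)]
    _ = _ := by
        rw [Finset.prod_mul_distrib, ← Real.rpow_sum_of_pos (by positivity), hw_sum,
          Real.rpow_one]

theorem measure_exists_lt_abs_sum_le (hφ : Function.Even φ) (hw : ∀ k ∈ s, 0 < w k)
    (hw_sum : ∑ k ∈ s, w k = 1) (hY : ∀ k ∈ s, ∀ q ∈ S k, HasMGFBound φ μ (Y k q) (e k))
    (hl : 0 ≤ l) (hB : ∀ k ∈ s, φ (e k * (l / w k)) ≤ B) (u : ℝ) :
    μ {ω | ∃ j : ι → T, (∀ k ∈ s, j k ∈ S k) ∧ u < |∑ k ∈ s, Y k (j k) ω|} ≤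
      ENNReal.ofReal (2 * Real.exp (B - l * u) * ∏ k ∈ s, ((S k).card : ℝ) ^ w k) := by
  set G : Ω → ℝ≥0∞ := fun ω => ∏ k ∈ s, expEnvelope (S k) (Y k) (l / w k) ω ^ w k
  have hG : AEMeasurable G μ := Finset.aemeasurable_fun_prod s fun k hk =>
    (aemeasurable_expEnvelope (hY k hk) _).pow_const (w k)
  calc _ ≤ μ {ω | ENNReal.ofReal (Real.exp (l * u)) ≤ G ω} := by
        refine measure_mono ?_
        rintro ω ⟨j, hj, hu⟩
        refine le_trans ?_ (ofReal_exp_mul_abs_sum_le_prod_expEnvelope hw hl Y hj ω)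
        gcongr
    _ ≤ (∫⁻ ω, G ω ∂μ) / ENNReal.ofReal (Real.exp (l * u)) :=
        meas_ge_le_lintegral_div hG (by simp [Real.exp_pos]) ENNReal.ofReal_ne_top
    _ ≤ ENNReal.ofReal (2 * Real.exp B * ∏ k ∈ s, ((S k).card : ℝ) ^ w k) /
        ENNReal.ofReal (Real.exp (l * u)) :=
        ENNReal.div_le_div_right (lintegral_prod_expEnvelope_le hφ hw hw_sum hY hB) _
    _ = _ := by
        rw [← ENNReal.ofReal_div_of_pos (Real.exp_pos _), Real.exp_sub]
        congr 1
        ring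

end ExpEnvelope

section Chaining

variable {T : Type*}

/-- The level-`k` link of a chain through the projections `π`: the value at the root for `k = 0`,
and the increment from `π (k - 1) q` to `q` otherwise. -/
def chainIncrement {E : Type*} [AddGroup E] (X : T → E) (π : ℕ → T → T) : ℕ → T → E
  | 0, q => X q
  | k + 1, q => X q - X (π k q)

theorem sum_chainIncrement {E : Type*} [AddCommGroup E] (X : T → E) (π : ℕ → T → T) {m : ℕ}
    {j : ℕ → T} (hj : ∀ k < m, j k = π k (j (k + 1))) :
    ∑ k ∈ Finset.range (m + 1), chainIncrement X π k (j k) = X (j m) := by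
  induction m with
  | zero => simp [chainIncrement]
  | succ m ih =>
    rw [Finset.sum_range_succ, ih fun k hk => hj k (by lia), hj m m.lt_succ_self, chainIncrement]
    abel

theorem exists_chain (π : ℕ → T → T) (m : ℕ) (p : T) :
    ∃ j : ℕ → T, j m = p ∧ ∀ k < m, j k = π k (j (k + 1)) := by
  induction m generalizing p with
  | zero => exact ⟨fun _ => p, rfl, by simp⟩
  | succ m ih =>
    obtain ⟨j, hj, hjk⟩ := ih (π m p)
    refine ⟨Function.update j (m + 1) p, by simp, fun k hk => ?_⟩
    rcases Nat.lt_succ_iff_lt_or_eq.1 hk with hk | rfl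
    · simp [hk.ne, (hk.trans m.lt_succ_self).ne, hjk k hk]
    · simp [hj]

/-- The Hölder weights of a chain of length `m`: `(1 - θ) * θ ^ k` for `k < m`, the remaining
mass `θ ^ m` being given to the last link. -/
noncomputable def chainWeight (θ : ℝ) (m k : ℕ) : ℝ := if k < m then (1 - θ) * θ ^ k else θ ^ m

theorem sum_chainWeight (θ : ℝ) (m : ℕ) : ∑ k ∈ Finset.range (m + 1), chainWeight θ m k = 1 := by
  have hlt : ∀ k ∈ Finset.range m, chainWeight θ m k = (1 - θ) * θ ^ k := fun k hk =>
    if_pos (Finset.mem_range.1 hk)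
  rw [Finset.sum_range_succ, Finset.sum_congr rfl hlt, ← Finset.mul_sum, mul_neg_geom_sum,
    chainWeight, if_neg (lt_irrefl m), sub_add_cancel]

theorem le_chainWeight {θ : ℝ} (hθ : 0 ≤ θ) {m k : ℕ} (hk : k ≤ m) :
    (1 - θ) * θ ^ k ≤ chainWeight θ m k := by
  rw [chainWeight]
  split_ifs with h
  · exact le_rfl
  · obtain rfl : k = m := by lia
    exact mul_le_of_le_one_left (pow_nonneg hθ k) (by linarith)

variable {Ω : Type*} [MeasurableSpace Ω] {μ : Measure Ω} {φ : ℝ → ℝ} {X : T → Ω → ℝ} {ε θ l : ℝ}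
  {V : ℕ → Finset T}

/-- The set `F` enters only through `F.card ^ θ ^ m`, which tends to `1` as the chain gets
longer. -/
theorem measure_exists_lt_abs_le_of_chain (hφ : IsYoungFunction φ) (hε : 0 ≤ ε) (hθ : 0 < θ)
    (hθ1 : θ < 1) (hX : ∀ p, HasMGFBound φ μ (X p) ε)
    (hV : ∀ k p, ∃ q ∈ V k, HasMGFBound φ μ (fun ω => X p ω - X q ω) (θ ^ (k + 1) * ε))
    (hl : 0 ≤ l) (u : ℝ) (m : ℕ) (F : Finset T) :
    μ {ω | ∃ p ∈ F, u < |X p ω|} ≤ ENNReal.ofReal (2 * Real.exp (φ (ε * (l / (1 - θ))) - l * u) *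
      ((∏ k ∈ Finset.range m, ((V k).card : ℝ) ^ ((1 - θ) * θ ^ k)) * (F.card : ℝ) ^ θ ^ m)) := by
  choose π hπ_mem hπ using hV
  have hθ' : 0 < 1 - θ := by linarith
  have hle {k : ℕ} (hk : k ∈ Finset.range (m + 1)) : (1 - θ) * θ ^ k ≤ chainWeight θ m k :=
    le_chainWeight hθ.le (Finset.mem_range_succ_iff.1 hk)
  have hpos (k : ℕ) : 0 < (1 - θ) * θ ^ k := by positivity
  set S : ℕ → Finset T := fun k => if k < m then V k else F with hS
  have hincr (k : ℕ) (q : T) : HasMGFBound φ μ (chainIncrement X π k q) (θ ^ k * ε) := by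
    cases k with
    | zero => simpa [chainIncrement] using hX q
    | succ k => exact hπ k q
  have hbound : ∀ k ∈ Finset.range (m + 1),
      φ (θ ^ k * ε * (l / chainWeight θ m k)) ≤ φ (ε * (l / (1 - θ))) := by
    intro k hk
    have := (hpos k).trans_le (hle hk)
    refine hφ.apply_le_apply_of_abs_le_abs (abs_le_abs_of_nonneg (by positivity) ?_)
    calc θ ^ k * ε * (l / chainWeight θ m k) ≤ θ ^ k * ε * (l / ((1 - θ) * θ ^ k)) := by
          have := hpos k
          gcongr
          exact hle hk
      _ = ε * (l / (1 - θ)) := by field_simp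
  have hsub : {ω | ∃ p ∈ F, u < |X p ω|} ⊆
      {ω | ∃ j : ℕ → T, (∀ k ∈ Finset.range (m + 1), j k ∈ S k) ∧
        u < |∑ k ∈ Finset.range (m + 1), chainIncrement X π k (j k) ω|} := by
    rintro ω ⟨p, hp, hu⟩
    obtain ⟨j, rfl, hj⟩ := exists_chain π m p
    refine ⟨j, fun k hk => ?_, by rwa [← Finset.sum_apply, sum_chainIncrement X π hj]⟩
    rcases (Finset.mem_range_succ_iff.1 hk).lt_or_eq with hk | rfl
    · simpa only [hS, if_pos hk, hj k hk] using hπ_mem k _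
    · simpa only [hS, lt_irrefl, if_false] using hp
  have hprod : ∏ k ∈ Finset.range (m + 1), ((S k).card : ℝ) ^ chainWeight θ m k =
      (∏ k ∈ Finset.range m, ((V k).card : ℝ) ^ ((1 - θ) * θ ^ k)) * (F.card : ℝ) ^ θ ^ m := by
    rw [Finset.prod_range_succ]
    congr 1
    · refine Finset.prod_congr rfl fun k hk => ?_
      simp only [hS, chainWeight, Finset.mem_range.1 hk, if_true]
    · simp only [hS, chainWeight, lt_irrefl, if_false]
  rw [← hprod]
  exact (measure_mono hsub).trans (measure_exists_lt_abs_sum_le hφ.even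
    (fun k hk => (hpos k).trans_le (hle hk)) (sum_chainWeight θ m) (fun k _ q _ => hincr k q) hl
    hbound u)

theorem measure_exists_lt_abs_le_of_prod_card_le (hφ : IsYoungFunction φ) (hε : 0 ≤ ε)
    (hθ : 0 < θ) (hθ1 : θ < 1) (hX : ∀ p, HasMGFBound φ μ (X p) ε)
    (hV : ∀ k p, ∃ q ∈ V k, HasMGFBound φ μ (fun ω => X p ω - X q ω) (θ ^ (k + 1) * ε)) {R : ℝ}
    (hR : ∀ m, ∏ k ∈ Finset.range m, ((V k).card : ℝ) ^ ((1 - θ) * θ ^ k) ≤ R) (hl : 0 ≤ l)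
    (u : ℝ) (F : Finset T) :
    μ {ω | ∃ p ∈ F, u < |X p ω|} ≤
      ENNReal.ofReal (2 * Real.exp (φ (ε * (l / (1 - θ))) - l * u) * R) := by
  rcases F.eq_empty_or_nonempty with rfl | hF
  · simp
  have hcard : Tendsto (fun m : ℕ => (F.card : ℝ) ^ θ ^ m) atTop (𝓝 1) := by
    rw [← Real.rpow_zero (F.card : ℝ)]
    exact ((Real.continuous_const_rpow (by exact_mod_cast hF.card_ne_zero)).tendsto 0).comp
      (tendsto_pow_atTop_nhds_zero_of_lt_one hθ.le hθ1)
  have hlim := ENNReal.tendsto_ofReal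
    ((hcard.const_mul R).const_mul (2 * Real.exp (φ (ε * (l / (1 - θ))) - l * u)))
  rw [mul_one] at hlim
  refine ge_of_tendsto' hlim fun m =>
    (measure_exists_lt_abs_le_of_chain hφ hε hθ hθ1 hX hV hl u m F).trans ?_
  gcongr
  exact hR m

end Chaining

section InverseR

/-- Above `g a`, a function that is convex on `[a, ∞)` and not maximal at `a` takes every value:
at the point `c` where the secant through `a` and `b` reaches `D`, the values of `g` at `min b c`
and at `max b c` lie on opposite sides of `D`. -/
theorem exists_eq_of_convexOn_Ici {g : ℝ → ℝ} {a b D : ℝ} (hg : ConvexOn ℝ (Ici a) g) (hab : a < b)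
    (hgab : g a < g b) (hD : g a ≤ D) : ∃ x ∈ Ici a, g x = D := by
  rcases hD.eq_or_lt with rfl | hD
  · exact ⟨a, self_mem_Ici, rfl⟩
  set s := (g b - g a) / (b - a) with hs_def
  have hs : 0 < s := div_pos (sub_pos.2 hgab) (sub_pos.2 hab)
  set c := a + (D - g a) / s with hc_def
  have hac : a < c := lt_add_of_pos_right a (div_pos (sub_pos.2 hD) hs)
  have hc : s * (c - a) = D - g a := by
    rw [hc_def, add_sub_cancel_left, mul_div_cancel₀ _ hs.ne']
  have secant_le {x y : ℝ} (hx : a < x) (hxy : x ≤ y) :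
      (g x - g a) / (x - a) ≤ (g y - g a) / (y - a) :=
    hg.secant_mono self_mem_Ici hx.le (hx.trans_le hxy).le hx.ne' (hx.trans_le hxy).ne' hxy
  have hmin : g (min b c) ≤ D := by
    have hlt : a < min b c := lt_min hab hac
    have := secant_le hlt (min_le_left b c)
    rw [← hs_def, div_le_iff₀ (sub_pos.2 hlt)] at this
    have : s * (min b c - a) ≤ s * (c - a) := by gcongr; exact min_le_right b c
    linarith
  have hmax : D ≤ g (max b c) := by
    have hlt : a < max b c := hab.trans_le (le_max_left b c)
    have := secant_le hab (le_max_left b c)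
    rw [← hs_def, le_div_iff₀ (sub_pos.2 hlt)] at this
    have : s * (c - a) ≤ s * (max b c - a) := by gcongr; exact le_max_right b c
    linarith
  have hcont : ContinuousOn g (Icc (min b c) (max b c)) :=
    hg.continuousOn_interior.mono fun x hx => by
      rw [interior_Ici]
      exact (lt_min hab hac).trans_le hx.1
  obtain ⟨x, hx, rfl⟩ := intermediate_value_Icc min_le_max hcont ⟨hmin, hmax⟩
  exact ⟨x, (lt_min hab hac).le.trans hx.1, rfl⟩

variable {r : ℝ → ℝ} (hr_mono : StrictMonoOn r (Ici 1))
  (hr_convex : ConvexOn ℝ (Ici 0) (fun x => r (Real.exp x)))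
include hr_mono hr_convex

theorem invR_spec {D : ℝ} (hD : r 1 ≤ D) : 1 ≤ invR r D ∧ r (invR r D) = D := by
  have hlt : r (Real.exp 0) < r (Real.exp 1) :=
    hr_mono (by simp) (by simp) (Real.exp_lt_exp.2 zero_lt_one)
  obtain ⟨x, hx, hxD⟩ := exists_eq_of_convexOn_Ici hr_convex zero_lt_one hlt (by simpa using hD)
  have hex : ∃ v ∈ Ici (1 : ℝ), r v = D := ⟨Real.exp x, Real.one_le_exp hx, hxD⟩
  exact ⟨Function.invFunOn_mem hex, Function.invFunOn_eq hex⟩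

theorem le_invR {x D : ℝ} (hx : 1 ≤ x) (hxD : r x ≤ D) : x ≤ invR r D := by
  obtain ⟨hmem, heq⟩ := invR_spec hr_mono hr_convex
    ((hr_mono.monotoneOn self_mem_Ici hx hx).trans hxD)
  exact (hr_mono.le_iff_le hx hmem).1 (hxD.trans heq.ge)

omit hr_mono in
/-- Jensen's inequality for the convex function `r ∘ exp`: a defect of the weights is charged to
the value at `exp 0 = 1`. -/
theorem apply_prod_rpow_le {ι : Type*} {s : Finset ι} {w x : ι → ℝ} (hw : ∀ i ∈ s, 0 ≤ w i)
    (hw_sum : ∑ i ∈ s, w i ≤ 1) (hx : ∀ i ∈ s, 1 ≤ x i) :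
    r (∏ i ∈ s, x i ^ w i) ≤ (1 - ∑ i ∈ s, w i) * r 1 + ∑ i ∈ s, w i * r (x i) := by
  have hpos : ∀ i ∈ s, 0 < x i := fun i hi => zero_lt_one.trans_le (hx i hi)
  have hJensen := hr_convex.map_add_sum_le (v := 1 - ∑ i ∈ s, w i) (q := 0)
    (p := fun i => Real.log (x i)) hw (sub_add_cancel _ _) (fun i hi => Real.log_nonneg (hx i hi))
    (sub_nonneg.2 hw_sum) self_mem_Ici
  calc r (∏ i ∈ s, x i ^ w i)
      = r (Real.exp ((1 - ∑ i ∈ s, w i) • 0 + ∑ i ∈ s, w i • Real.log (x i))) := by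
        rw [smul_zero, zero_add, Real.exp_sum]
        congr 1
        exact Finset.prod_congr rfl fun i hi => by
          rw [smul_eq_mul, mul_comm, Real.rpow_def_of_pos (hpos i hi)]
    _ ≤ _ := hJensen
    _ = _ := by
        rw [Real.exp_zero, smul_eq_mul]
        congr 1
        exact Finset.sum_congr rfl fun i hi => by rw [smul_eq_mul, Real.exp_log (hpos i hi)]

end InverseR

section GeometricScales

variable {g : ℝ → ℝ} {E θ : ℝ}

theorem pow_mul_mem_Ioc (hE : 0 < E) (hθ : 0 < θ) (hθ1 : θ < 1) (k : ℕ) : θ ^ k * E ∈ Ioc 0 E :=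
  ⟨by positivity, mul_le_of_le_one_left hE.le (pow_le_one₀ hθ.le hθ1.le)⟩

theorem geom_sum_mul_le_integral (hE : 0 < E) (hθ : 0 < θ) (hθ1 : θ < 1)
    (hg : AntitoneOn g (Ioc 0 E)) (hint : IntervalIntegrable g volume 0 E) (m : ℕ) :
    (∑ k ∈ Finset.range m, (1 - θ) * θ ^ k * g (θ ^ k * E)) * E ≤ ∫ v in (θ ^ m * E)..E, g v := by
  have hmem (k : ℕ) := pow_mul_mem_Ioc hE hθ hθ1 k
  have hsub {x z : ℝ} (hx : x ∈ Ioc 0 E) (hz : z ∈ Ioc 0 E) : IntervalIntegrable g volume x z :=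
    hint.mono_set (by
      rw [uIcc_of_le hE.le]
      exact uIcc_subset_Icc (Ioc_subset_Icc_self hx) (Ioc_subset_Icc_self hz))
  induction m with
  | zero => simp
  | succ m ih =>
    have hle : θ ^ (m + 1) * E ≤ θ ^ m * E :=
      mul_le_mul_of_nonneg_right (pow_le_pow_of_le_one hθ.le hθ1.le m.le_succ) hE.le
    have hstep : (1 - θ) * θ ^ m * g (θ ^ m * E) * E ≤
        ∫ v in (θ ^ (m + 1) * E)..(θ ^ m * E), g v :=
      calc _ = ∫ _ in (θ ^ (m + 1) * E)..(θ ^ m * E), g (θ ^ m * E) := by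
            rw [intervalIntegral.integral_const, smul_eq_mul]
            ring
        _ ≤ _ := intervalIntegral.integral_mono_on hle intervalIntegrable_const
            (hsub (hmem (m + 1)) (hmem m)) fun x hx =>
            hg ⟨(hmem (m + 1)).1.trans_le hx.1, hx.2.trans (hmem m).2⟩ (hmem m) hx.2
    rw [Finset.sum_range_succ, add_mul, add_comm,
      ← intervalIntegral.integral_add_adjacent_intervals (hsub (hmem (m + 1)) (hmem m))
        (hsub (hmem m) ⟨hE, le_rfl⟩)]
    exact add_le_add hstep ih

theorem pow_mul_le_integral (hE : 0 < E) (hθ : 0 < θ) (hθ1 : θ < 1) {b : ℝ}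
    (hb : ∀ v ∈ Ioc 0 E, b ≤ g v) (hint : IntervalIntegrable g volume 0 E) (m : ℕ) :
    θ ^ m * b * E ≤ ∫ v in (0 : ℝ)..(θ ^ m * E), g v := by
  obtain ⟨hpos, hle⟩ := pow_mul_mem_Ioc hE hθ hθ1 m
  calc θ ^ m * b * E = ∫ _ in (0 : ℝ)..(θ ^ m * E), b := by
        rw [intervalIntegral.integral_const, smul_eq_mul]
        ring
    _ ≤ _ := intervalIntegral.integral_mono_on_of_le_Ioo hpos.le intervalIntegrable_const
        (hint.mono_set (uIcc_subset_uIcc left_mem_uIcc (by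
          rw [uIcc_of_le hE.le]
          exact ⟨hpos.le, hle⟩)))
        fun v hv => hb v ⟨hv.1, hv.2.le.trans hle⟩

/-- The left side is `1 / E` times the integral over `(0, E]` of the step function equal to `b` on
`(0, θ ^ m * E]` and to `g (θ ^ k * E)` on `(θ ^ (k + 1) * E, θ ^ k * E]` for `k < m`. -/
theorem pow_mul_add_geom_sum_le_average (hE : 0 < E) (hθ : 0 < θ) (hθ1 : θ < 1)
    (hg : AntitoneOn g (Ioc 0 E)) {b : ℝ} (hb : ∀ v ∈ Ioc 0 E, b ≤ g v)
    (hint : IntervalIntegrable g volume 0 E) (m : ℕ) :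
    θ ^ m * b + ∑ k ∈ Finset.range m, (1 - θ) * θ ^ k * g (θ ^ k * E) ≤
      (∫ v in (0 : ℝ)..E, g v) / E := by
  have hmem : θ ^ m * E ∈ uIcc 0 E := by
    rw [uIcc_of_le hE.le]
    exact Ioc_subset_Icc_self (pow_mul_mem_Ioc hE hθ hθ1 m)
  rw [le_div_iff₀ hE, add_mul, ← intervalIntegral.integral_add_adjacent_intervals
    (hint.mono_set (uIcc_subset_uIcc_left hmem)) (hint.mono_set (uIcc_subset_uIcc_right hmem))]
  exact add_le_add (pow_mul_le_integral hE hθ hθ1 hb hint m)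
    (geom_sum_mul_le_integral hE hθ hθ1 hg hint m)

theorem prod_rpow_le_invR {r N : ℝ → ℝ} (hr_mono : StrictMonoOn r (Ici 1))
    (hr_convex : ConvexOn ℝ (Ici 0) (fun x => r (Real.exp x))) (hE : 0 < E) (hθ : 0 < θ)
    (hθ1 : θ < 1) (hN_one : ∀ v ∈ Ioc 0 E, 1 ≤ N v) (hN : AntitoneOn N (Ioc 0 E))
    (hint : IntervalIntegrable (fun v => r (N v)) volume 0 E) (m : ℕ) :
    ∏ k ∈ Finset.range m, N (θ ^ k * E) ^ ((1 - θ) * θ ^ k) ≤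
      invR r ((∫ v in (0 : ℝ)..E, r (N v)) / E) := by
  have hweight (k : ℕ) : 0 ≤ (1 - θ) * θ ^ k := mul_nonneg (sub_pos.2 hθ1).le (pow_nonneg hθ.le k)
  have hsum : ∑ k ∈ Finset.range m, (1 - θ) * θ ^ k = 1 - θ ^ m := by
    rw [← Finset.mul_sum, mul_neg_geom_sum]
  have hone (k : ℕ) : 1 ≤ N (θ ^ k * E) := hN_one _ (pow_mul_mem_Ioc hE hθ hθ1 k)
  refine le_invR hr_mono hr_convex
    (Finset.one_le_prod fun k _ => Real.one_le_rpow (hone k) (hweight k)) ?_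
  have hr_anti : AntitoneOn (fun v => r (N v)) (Ioc 0 E) := fun x hx z hz hxz =>
    hr_mono.monotoneOn (hN_one z hz) (hN_one x hx) (hN hx hz hxz)
  calc _ ≤ (1 - ∑ k ∈ Finset.range m, (1 - θ) * θ ^ k) * r 1 +
        ∑ k ∈ Finset.range m, (1 - θ) * θ ^ k * r (N (θ ^ k * E)) :=
        apply_prod_rpow_le hr_convex (fun k _ => hweight k)
          (by linarith [pow_nonneg hθ.le m]) fun k _ => hone k
    _ = θ ^ m * r 1 + ∑ k ∈ Finset.range m, (1 - θ) * θ ^ k * r (N (θ ^ k * E)) := by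
        rw [hsum, sub_sub_cancel]
    _ ≤ _ := pow_mul_add_geom_sum_le_average hE hθ hθ1 hr_anti
        (fun v hv => hr_mono.monotoneOn self_mem_Ici (hN_one v hv) (hN_one v hv)) hint m

end GeometricScales

section TailBound

variable {φ : ℝ → ℝ}

theorem le_exp_neg_conj_mul (hφ : IsYoungFunction φ) {m R x : ℝ} (hm : 0 ≤ m) (hR : 0 < R)
    (hx : 0 ≤ x) (h : ∀ l, 0 ≤ l → m ≤ Real.exp (φ l - x * l) * R) :
    m ≤ Real.exp (-conj φ x) * R := by
  rcases hm.eq_or_lt with rfl | hm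
  · positivity
  have hconj : conj φ x ≤ Real.log (R / m) := by
    refine ciSup_le fun l => (?_ : x * l - φ l ≤ x * |l| - φ |l|).trans ?_
    · rw [hφ.apply_abs]
      gcongr
      exact le_abs_self l
    · rw [Real.le_log_iff_exp_le (by positivity), le_div_iff₀ hm, ← neg_sub (φ |l|), Real.exp_neg]
      exact inv_mul_le_of_le_mul₀ (Real.exp_pos _).le hR.le (h |l| (abs_nonneg l))
  calc m = Real.exp (-Real.log (R / m)) * R := by
        rw [Real.exp_neg, Real.exp_log (by positivity)]
        field_simp
    _ ≤ _ := by gcongr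

variable {Ω T : Type*} [MeasurableSpace Ω] {μ : Measure Ω} [IsFiniteMeasure μ] {X : T → Ω → ℝ}
  {ε θ u : ℝ}

theorem measure_exists_lt_abs_le_exp_neg_conj_mul (hφ : IsYoungFunction φ) (hε : 0 < ε)
    (hθ : 0 < θ) (hθ1 : θ < 1) (hu : 0 ≤ u) (hX : ∀ p, HasMGFBound φ μ (X p) ε) {V : ℕ → Finset T}
    (hV : ∀ k p, ∃ q ∈ V k, HasMGFBound φ μ (fun ω => X p ω - X q ω) (θ ^ (k + 1) * ε)) {R : ℝ}
    (hR : ∀ m, ∏ k ∈ Finset.range m, ((V k).card : ℝ) ^ ((1 - θ) * θ ^ k) ≤ R) (F : Finset T) :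
    μ {ω | ∃ p ∈ F, u < |X p ω|} ≤
      ENNReal.ofReal (2 * (Real.exp (-conj φ (u * (1 - θ) / ε)) * R)) := by
  have hθ' : 0 < 1 - θ := sub_pos.2 hθ1
  have hR_pos : 0 < R := zero_lt_one.trans_le (by simpa using hR 0)
  rw [← ENNReal.ofReal_toReal (measure_ne_top μ _), mul_left_comm]
  refine ENNReal.ofReal_le_ofReal (le_exp_neg_conj_mul hφ ENNReal.toReal_nonneg (by positivity)
    (by positivity) fun l hl => ENNReal.toReal_le_of_le_ofReal (by positivity) ?_)
  have hexp : ε * (l * (1 - θ) / ε / (1 - θ)) = l := by field_simp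
  have hlin : l * (1 - θ) / ε * u = u * (1 - θ) / ε * l := by ring
  have htail := measure_exists_lt_abs_le_of_prod_card_le hφ hε.le hθ hθ1 hX hV hR
    (l := l * (1 - θ) / ε) (by positivity) u F
  rwa [hexp, hlin, mul_assoc, mul_left_comm] at htail

/-- The nets at the scales `θ ^ k * (θ * ε)` are combined through Jensen's inequality for
`r ∘ exp`, which replaces their cardinalities by the entropy integral. -/
theorem measure_exists_lt_abs_le_invR_integral (hφ : IsYoungFunction φ) (hε : 0 < ε) (hθ : 0 < θ)
    (hθ1 : θ < 1) (hu : 0 ≤ u) (hX : ∀ p, HasMGFBound φ μ (X p) ε) {r N : ℝ → ℝ}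
    (hr_mono : StrictMonoOn r (Ici 1)) (hr_convex : ConvexOn ℝ (Ici 0) (fun x => r (Real.exp x)))
    (hN_one : ∀ v ∈ Ioc 0 (θ * ε), 1 ≤ N v) (hN : AntitoneOn N (Ioc 0 (θ * ε)))
    (hint : IntervalIntegrable (fun v => r (N v)) volume 0 (θ * ε))
    (hnet : ∀ v ∈ Ioc 0 (θ * ε), ∃ V : Finset T, (V.card : ℝ) ≤ N v ∧
      ∀ p, ∃ q ∈ V, HasMGFBound φ μ (fun ω => X p ω - X q ω) v) (F : Finset T) :
    μ {ω | ∃ p ∈ F, u < |X p ω|} ≤ ENNReal.ofReal (2 * (Real.exp (-conj φ (u * (1 - θ) / ε)) *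
      invR r ((∫ v in (0 : ℝ)..(θ * ε), r (N v)) / (θ * ε)))) := by
  have hE : 0 < θ * ε := mul_pos hθ hε
  choose V hV_card hV using fun k => hnet _ (pow_mul_mem_Ioc hE hθ hθ1 k)
  refine measure_exists_lt_abs_le_exp_neg_conj_mul hφ hε hθ hθ1 hu hX (V := V)
    (fun k p => ?_) (fun m => ?_) F
  · simpa only [pow_succ, mul_assoc] using hV k p
  · refine le_trans ?_ (prod_rpow_le_invR hr_mono hr_convex hE hθ hθ1 hN_one hN hint m)
    have := sub_pos.2 hθ1
    gcongr with k
    exact hV_card k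

end TailBound

section Net

theorem abs_sub_min_midpoint_le {a b h x : ℝ} (hh : 0 < h) (hx : x ∈ Icc a b) :
    |x - min (a + (2 * ⌊(x - a) / (2 * h)⌋₊ + 1) * h) b| ≤ h := by
  have hfloor := Nat.floor_le (div_nonneg (sub_nonneg.2 hx.1) (mul_pos two_pos hh).le)
  have hlt_floor := Nat.lt_floor_add_one ((x - a) / (2 * h))
  rw [le_div_iff₀ (by positivity)] at hfloor
  rw [div_lt_iff₀ (by positivity)] at hlt_floor
  rw [abs_sub_le_iff]
  constructor
  · rw [sub_le_comm, le_min_iff]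
    exact ⟨by linarith, by linarith [hx.2]⟩
  · rw [sub_le_iff_le_add]
    exact (min_le_left _ _).trans (by linarith)

theorem exists_net_Icc {a b h : ℝ} (hab : a ≤ b) (hh : 0 < h) :
    ∃ S : Finset ℝ, ↑S ⊆ Icc a b ∧ (S.card : ℝ) ≤ (b - a) / (2 * h) + 1 ∧
      ∀ x ∈ Icc a b, ∃ s ∈ S, |x - s| ≤ h := by
  refine ⟨(Finset.range (⌊(b - a) / (2 * h)⌋₊ + 1)).image
    fun i : ℕ => min (a + (2 * i + 1) * h) b, ?_, ?_, fun x hx => ⟨_, Finset.mem_image.2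
      ⟨⌊(x - a) / (2 * h)⌋₊, ?_, rfl⟩, abs_sub_min_midpoint_le hh hx⟩⟩
  · simp only [Finset.coe_image, image_subset_iff]
    exact fun i _ => ⟨le_min (le_add_of_nonneg_right (by positivity)) hab, min_le_right _ _⟩
  · refine (Nat.cast_le.2 Finset.card_image_le).trans ?_
    rw [Finset.card_range, Nat.cast_add_one]
    gcongr
    exact Nat.floor_le (div_nonneg (sub_nonneg.2 hab) (by positivity))
  · rw [Finset.mem_range_succ_iff]
    have := hx.2
    gcongr

theorem exists_net_rect {a b c d h : ℝ} (hab : a ≤ b) (hcd : c ≤ d) (hh : 0 < h) :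
    ∃ V : Finset ↥(Icc a b ×ˢ Icc c d),
      (V.card : ℝ) ≤ ((b - a) / (2 * h) + 1) * ((d - c) / (2 * h) + 1) ∧
      ∀ p : ↥(Icc a b ×ˢ Icc c d), ∃ q ∈ V, |p.1.1 - q.1.1| ≤ h ∧ |p.1.2 - q.1.2| ≤ h := by
  classical
  obtain ⟨S, hS, hS_card, hS_net⟩ := exists_net_Icc hab hh
  obtain ⟨S', hS', hS'_card, hS'_net⟩ := exists_net_Icc hcd hh
  refine ⟨(S ×ˢ S').subtype (· ∈ Icc a b ×ˢ Icc c d), ?_, fun ⟨p, hp⟩ => ?_⟩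
  · rw [Finset.card_subtype]
    calc _ ≤ (S.card * S'.card : ℝ) :=
          mod_cast (Finset.card_filter_le _ _).trans_eq (Finset.card_product _ _)
      _ ≤ _ := mul_le_mul hS_card hS'_card (Nat.cast_nonneg _)
          ((Nat.cast_nonneg _).trans hS_card)
  · obtain ⟨s, hs, hps⟩ := hS_net p.1 hp.1
    obtain ⟨s', hs', hps'⟩ := hS'_net p.2 hp.2
    exact ⟨⟨(s, s'), hS hs, hS' hs'⟩, by simp [hs, hs'], hps, hps'⟩

end Net

section InverseModulus

variable {Z : ℝ → ℝ} {u₀ C H : ℝ}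

/-- The reciprocal `Z⁻¹ (2 C / v) - u₀` of `σ⁻¹ v` for `v ≤ σ(H)`. For larger `v` it is `0`: one
ball of infinite radius covers the whole parameter set. -/
noncomputable def invRadius (Z : ℝ → ℝ) (u₀ C H v : ℝ) : ℝ :=
  if v ≤ sigma Z u₀ C H then invZ Z (2 * C / v) - u₀ else 0

namespace IsScaleFunction

variable (hZ : IsScaleFunction Z u₀)
include hZ

theorem exists_apply_eq {w : ℝ} (hw : Z 0 ≤ w) : ∃ x ∈ Ici (0 : ℝ), Z x = w :=
  isPreconnected_Ici.intermediate_value_Ici self_mem_Ici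
    (le_principal_iff.2 (Ici_mem_atTop 0)) hZ.continuousOn hZ.tendsto_top hw

theorem apply_invZ {w : ℝ} (hw : Z 0 ≤ w) : Z (invZ Z w) = w :=
  Function.invFunOn_eq (hZ.exists_apply_eq hw)

theorem invZ_nonneg {w : ℝ} (hw : Z 0 ≤ w) : 0 ≤ invZ Z w :=
  Function.invFunOn_mem (hZ.exists_apply_eq hw)

theorem le_invZ {w x : ℝ} (hx : 0 ≤ x) (hw : Z x ≤ w) : x ≤ invZ Z w := by
  have hw₀ : Z 0 ≤ w := (hZ.strictMonoOn.monotoneOn self_mem_Ici hx hx).trans hw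
  rwa [← hZ.strictMonoOn.le_iff_le hx (hZ.invZ_nonneg hw₀), hZ.apply_invZ hw₀]

theorem monotoneOn_invZ : MonotoneOn (invZ Z) (Ici (Z 0)) := fun _ hw _ _ hww' =>
  hZ.le_invZ (hZ.invZ_nonneg hw) ((hZ.apply_invZ hw).trans_le hww')

theorem apply_one_div_add_pos {h : ℝ} (hh : 0 < h) : 0 < Z (1 / h + u₀) :=
  hZ.pos _ (add_pos_of_pos_of_nonneg (one_div_pos.2 hh) hZ.u₀_nonneg)

theorem sigma_nonneg (hC : 0 ≤ C) (hH : 0 < H) : 0 ≤ sigma Z u₀ C H :=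
  div_nonneg (mul_nonneg zero_le_two hC) (hZ.apply_one_div_add_pos hH).le

theorem injOn_sigma (hC : C ≠ 0) : InjOn (sigma Z u₀ C) (Ioi 0) := by
  intro x hx z hz hxz
  have hu₀ := hZ.u₀_nonneg
  have hZeq : Z (1 / x + u₀) = Z (1 / z + u₀) :=
    inv_injective (mul_left_cancel₀ (mul_ne_zero two_ne_zero hC) hxz)
  have hxz_inv := hZ.strictMonoOn.injOn
    (add_nonneg (one_div_pos.2 hx).le hu₀) (add_nonneg (one_div_pos.2 hz).le hu₀) hZeq
  simpa using hxz_inv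

variable (hH : 0 < H) {v : ℝ} (hv : 0 < v)
include hH hv

theorem apply_le_two_mul_div (hvH : v ≤ sigma Z u₀ C H) : Z (1 / H + u₀) ≤ 2 * C / v := by
  rwa [le_div_comm₀ (hZ.apply_one_div_add_pos hH) hv]

theorem apply_zero_le_two_mul_div (hvH : v ≤ sigma Z u₀ C H) : Z 0 ≤ 2 * C / v := by
  have hnonneg : 0 ≤ 1 / H + u₀ := add_nonneg (one_div_pos.2 hH).le hZ.u₀_nonneg
  exact (hZ.strictMonoOn.monotoneOn self_mem_Ici hnonneg hnonneg).trans
    (hZ.apply_le_two_mul_div hH hv hvH)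

theorem one_div_le_invRadius (hvH : v ≤ sigma Z u₀ C H) : 1 / H ≤ invRadius Z u₀ C H v := by
  rw [invRadius, if_pos hvH, le_sub_iff_add_le]
  exact hZ.le_invZ (add_nonneg (one_div_pos.2 hH).le hZ.u₀_nonneg)
    (hZ.apply_le_two_mul_div hH hv hvH)

theorem invRadius_nonneg : 0 ≤ invRadius Z u₀ C H v := by
  by_cases hvH : v ≤ sigma Z u₀ C H
  · exact (one_div_pos.2 hH).le.trans (hZ.one_div_le_invRadius hH hv hvH)
  · rw [invRadius, if_neg hvH]

theorem one_div_invRadius_mem_Ioc (hvH : v ≤ sigma Z u₀ C H) :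
    1 / invRadius Z u₀ C H v ∈ Ioc 0 H := by
  have hle := hZ.one_div_le_invRadius hH hv hvH
  have hpos := (one_div_pos.2 hH).trans_le hle
  exact ⟨one_div_pos.2 hpos, (one_div_le hpos hH).2 hle⟩

theorem sigma_one_div_invRadius (hvH : v ≤ sigma Z u₀ C H) :
    sigma Z u₀ C (1 / invRadius Z u₀ C H v) = v := by
  have hpos := (hZ.apply_one_div_add_pos hH).trans_le (hZ.apply_le_two_mul_div hH hv hvH)
  rw [invRadius, if_pos hvH, sigma, one_div_one_div, sub_add_cancel,
    hZ.apply_invZ (hZ.apply_zero_le_two_mul_div hH hv hvH),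
    div_div_cancel₀ ((div_pos_iff_of_pos_right hv).1 hpos).ne']

theorem invSigma_eq_one_div_invRadius (hvH : v ≤ sigma Z u₀ C H) :
    invSigma (sigma Z u₀ C) H v = 1 / invRadius Z u₀ C H v := by
  have hmem := hZ.one_div_invRadius_mem_Ioc hH hv hvH
  have hσ := hZ.sigma_one_div_invRadius hH hv hvH
  have hex : ∃ h ∈ Ioc 0 H, sigma Z u₀ C h = v := ⟨_, hmem, hσ⟩
  have hC : C ≠ 0 := by
    rintro rfl
    simp [sigma, hv.not_ge] at hvH
  exact hZ.injOn_sigma hC (Function.invFunOn_mem hex).1 hmem.1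
    ((Function.invFunOn_eq hex).trans hσ.symm)

omit hv in
theorem antitoneOn_invRadius : AntitoneOn (invRadius Z u₀ C H) (Ioi 0) := by
  intro v hv v' hv' hvv'
  by_cases hvH : v' ≤ sigma Z u₀ C H
  · have hC : 0 ≤ 2 * C := by
      by_contra! hC
      exact hv'.not_ge (hvH.trans (div_nonpos_of_nonpos_of_nonneg hC.le
        (hZ.apply_one_div_add_pos hH).le))
    have hw' := hZ.apply_zero_le_two_mul_div hH hv' hvH
    have hww' : 2 * C / v' ≤ 2 * C / v := div_le_div_of_nonneg_left hC hv hvv'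
    rw [invRadius, invRadius, if_pos hvH, if_pos (hvv'.trans hvH)]
    exact sub_le_sub_right (hZ.monotoneOn_invZ hw' (hw'.trans hww') hww') u₀
  · rw [invRadius, if_neg hvH]
    exact hZ.invRadius_nonneg hH hv

end IsScaleFunction

end InverseModulus

section Entropy

theorem uIoc_zero_min_subset {E γ : ℝ} (hE : 0 ≤ E) (hγ : 0 ≤ γ) : uIoc 0 (min E γ) ⊆ Ioc 0 γ := by
  rw [uIoc_of_le (le_min hE hγ)]
  exact Ioc_subset_Ioc_right (min_le_right E γ)

theorem uIoc_min_self_subset (E γ : ℝ) : uIoc (min E γ) E ⊆ Ioi γ := by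
  rw [uIoc_of_le (min_le_left E γ)]
  exact fun v hv => (min_lt_iff.1 hv.1).resolve_left hv.2.not_gt

theorem intervalIntegrable_of_eqOn_Ioc_of_eqOn_Ioi {f g : ℝ → ℝ} {E γ k : ℝ} (hE : 0 ≤ E)
    (hγ : 0 ≤ γ) (hf : IntervalIntegrable f volume 0 (min E γ)) (hfg : EqOn f g (Ioc 0 γ))
    (hk : EqOn (fun _ => k) g (Ioi γ)) : IntervalIntegrable g volume 0 E :=
  (hf.congr (hfg.mono (uIoc_zero_min_subset hE hγ))).trans
    (intervalIntegrable_const.congr (hk.mono (uIoc_min_self_subset E γ)))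

theorem integral_eq_of_eqOn_Ioc_of_eqOn_Ioi {f g : ℝ → ℝ} {E γ k : ℝ} (hE : 0 ≤ E) (hγ : 0 ≤ γ)
    (hg : IntervalIntegrable g volume 0 E) (hfg : EqOn g f (Ioc 0 γ))
    (hk : EqOn g (fun _ => k) (Ioi γ)) :
    ∫ v in (0 : ℝ)..E, g v = (∫ v in (0 : ℝ)..min E γ, f v) + k * max (E - γ) 0 := by
  have hmem : min E γ ∈ uIcc 0 E := by
    rw [uIcc_of_le hE]
    exact ⟨le_min hE hγ, min_le_left E γ⟩
  have hlow : ∫ v in (0 : ℝ)..min E γ, g v = ∫ v in (0 : ℝ)..min E γ, f v :=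
    intervalIntegral.integral_congr_ae (ae_of_all _ (hfg.mono (uIoc_zero_min_subset hE hγ)))
  have hhigh : ∫ v in min E γ..E, g v = ∫ _ in min E γ..E, k :=
    intervalIntegral.integral_congr_ae (ae_of_all _ (hk.mono (uIoc_min_self_subset E γ)))
  have hlength : E - min E γ = max (E - γ) 0 := by
    rw [← max_sub_sub_left, sub_self, max_comm]
  rw [← intervalIntegral.integral_add_adjacent_intervals
    (hg.mono_set (uIcc_subset_uIcc_left hmem)) (hg.mono_set (uIcc_subset_uIcc_right hmem)),
    hlow, hhigh, intervalIntegral.integral_const, hlength, smul_eq_mul, mul_comm k]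

end Entropy

section CoveringNumber

/-- The bound for the number of balls of radius `v` that cover a rectangle with sides `L₁`, `L₂`, in
the metric given by the modulus `σ` of the distance `max |t - t'| |x - x'|`. -/
noncomputable def coverBound (Z : ℝ → ℝ) (u₀ C L₁ L₂ v : ℝ) : ℝ :=
  (L₁ / 2 * invRadius Z u₀ C (max L₁ L₂) v + 1) * (L₂ / 2 * invRadius Z u₀ C (max L₁ L₂) v + 1)

variable {Z : ℝ → ℝ} {u₀ C L₁ L₂ v : ℝ}

theorem coverBound_of_sigma_lt (hv : sigma Z u₀ C (max L₁ L₂) < v) :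
    coverBound Z u₀ C L₁ L₂ v = 1 := by
  simp only [coverBound, invRadius, if_neg hv.not_ge, mul_zero, zero_add, mul_one]

theorem coverBound_eq_of_invRadius {h : ℝ} (hh : h = 1 / invRadius Z u₀ C (max L₁ L₂) v) :
    coverBound Z u₀ C L₁ L₂ v = (L₁ / (2 * h) + 1) * (L₂ / (2 * h) + 1) := by
  have hdiv (L : ℝ) : L / (2 * h) = L / 2 * invRadius Z u₀ C (max L₁ L₂) v := by
    rw [hh, ← div_div, div_div_eq_mul_div, div_one]
  rw [coverBound, hdiv, hdiv]

namespace IsScaleFunction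

variable (hZ : IsScaleFunction Z u₀)
include hZ

theorem one_le_coverBound (h₁ : 0 ≤ L₁) (h₂ : 0 ≤ L₂) (hL : 0 < max L₁ L₂) (hv : 0 < v) :
    1 ≤ coverBound Z u₀ C L₁ L₂ v := by
  have := hZ.invRadius_nonneg (C := C) hL hv
  exact one_le_mul_of_one_le_of_one_le (le_add_of_nonneg_left (by positivity))
    (le_add_of_nonneg_left (by positivity))

theorem antitoneOn_coverBound (h₁ : 0 ≤ L₁) (h₂ : 0 ≤ L₂) (hL : 0 < max L₁ L₂) :
    AntitoneOn (coverBound Z u₀ C L₁ L₂) (Ioi 0) := by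
  intro v hv v' hv' hvv'
  have := hZ.invRadius_nonneg (C := C) hL hv
  have := hZ.invRadius_nonneg (C := C) hL hv'
  have := hZ.antitoneOn_invRadius (C := C) hL hv hv' hvv'
  unfold coverBound
  gcongr

theorem entropyIntegrand_eqOn (r : ℝ → ℝ) (hL : 0 < max L₁ L₂) :
    EqOn (entropyIntegrand r (sigma Z u₀ C) L₁ L₂) (fun v => r (coverBound Z u₀ C L₁ L₂ v))
      (Ioc 0 (sigma Z u₀ C (max L₁ L₂))) := fun v hv => by
  simp only [entropyIntegrand,
    coverBound_eq_of_invRadius (hZ.invSigma_eq_one_div_invRadius hL hv.1 hv.2)]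

variable {r : ℝ → ℝ} {E : ℝ} (hL : 0 < max L₁ L₂) (hC : 0 ≤ C) (hE : 0 ≤ E)
  (hr : ∀ ε, 0 < ε → ε ≤ sigma Z u₀ C (max L₁ L₂) →
    IntegrableOn (entropyIntegrand r (sigma Z u₀ C) L₁ L₂) (Ioc 0 ε))
include hL hC hE hr

theorem intervalIntegrable_entropyIntegrand : IntervalIntegrable
    (entropyIntegrand r (sigma Z u₀ C) L₁ L₂) volume 0 (min E (sigma Z u₀ C (max L₁ L₂))) := by
  have hnonneg := le_min hE (hZ.sigma_nonneg hC hL)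
  rcases hnonneg.eq_or_lt with h | h
  · rw [← h]
  · exact (intervalIntegrable_iff_integrableOn_Ioc_of_le hnonneg).2 (hr _ h (min_le_right _ _))

theorem intervalIntegrable_coverBound :
    IntervalIntegrable (fun v => r (coverBound Z u₀ C L₁ L₂ v)) volume 0 E :=
  intervalIntegrable_of_eqOn_Ioc_of_eqOn_Ioi hE (hZ.sigma_nonneg hC hL)
    (hZ.intervalIntegrable_entropyIntegrand hL hC hE hr)
    (hZ.entropyIntegrand_eqOn r hL) fun v hv => by rw [coverBound_of_sigma_lt hv]

theorem integral_coverBound :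
    ∫ v in (0 : ℝ)..E, r (coverBound Z u₀ C L₁ L₂ v) =
      hatI r Z u₀ C L₁ L₂ (min E (sigma Z u₀ C (max L₁ L₂))) +
        r 1 * max (E - sigma Z u₀ C (max L₁ L₂)) 0 :=
  integral_eq_of_eqOn_Ioc_of_eqOn_Ioi hE (hZ.sigma_nonneg hC hL)
    (hZ.intervalIntegrable_coverBound hL hC hE hr)
    (fun v hv => by simp only [coverBound, invRadius, if_pos hv.2])
    fun v hv => by rw [coverBound_of_sigma_lt hv]

end IsScaleFunction

end CoveringNumber

section Separability

variable {Ω : Type*} [MeasurableSpace Ω] {μ : Measure Ω} {φ : ℝ → ℝ}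

theorem measure_exists_lt_abs_le_of_forall_finset {T : Type*} [TopologicalSpace T]
    [TopologicalSpace.SeparableSpace T] {X : T → Ω → ℝ}
    (hX : ∀ᵐ ω ∂μ, Continuous fun p => X p ω) {u : ℝ} {B : ℝ≥0∞}
    (hB : ∀ F : Finset T, μ {ω | ∃ p ∈ F, u < |X p ω|} ≤ B) : μ {ω | ∃ p, u < |X p ω|} ≤ B := by
  classical
  obtain ⟨D, hD_countable, hD⟩ := TopologicalSpace.exists_countable_dense T
  have := hD_countable.to_subtype
  let A (F : Finset D) : Set Ω := {ω | ∃ p ∈ F.map (.subtype _), u < |X p ω|}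
  have hA : Directed (· ⊆ ·) A := directed_of_isDirected_le fun F F' hFF' ω ⟨p, hp, h⟩ =>
    ⟨p, Finset.map_subset_map.2 hFF' hp, h⟩
  have hsub : {ω | ∃ p, u < |X p ω|} ≤ᵐ[μ] ⋃ F, A F := by
    filter_upwards [hX] with ω hω ⟨p, hp⟩
    obtain ⟨q, hqD, hq⟩ := hD.exists_mem_open (isOpen_lt continuous_const hω.abs) ⟨p, hp⟩
    exact mem_iUnion.2 ⟨{⟨q, hqD⟩}, q, by simp, hq⟩
  calc μ {ω | ∃ p, u < |X p ω|} ≤ μ (⋃ F, A F) := measure_mono_ae hsub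
    _ = ⨆ F, μ (A F) := hA.measure_iUnion
    _ ≤ B := iSup_le fun F => hB _

theorem measure_exists_lt_abs_eq_zero [IsProbabilityMeasure μ] (hφ : φ 0 = 0) {T : Type*}
    {X : T → Ω → ℝ} (hX : ∀ p, HasMGFBound φ μ (X p) 0) (F : Finset T) {u : ℝ} (hu : 0 ≤ u) :
    μ {ω | ∃ p ∈ F, u < |X p ω|} = 0 := by
  have hzero : ∀ᵐ ω ∂μ, ∀ p ∈ F, X p ω = 0 :=
    (Finset.eventually_all F).2 fun p _ => (hX p).ae_eq_zero hφ
  rw [measure_eq_zero_iff_ae_notMem]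
  filter_upwards [hzero] with ω hω ⟨p, hp, h⟩
  rw [hω p hp, abs_zero] at h
  exact h.not_ge hu

theorem measure_exists_lt_abs_le_of_continuous [IsProbabilityMeasure μ] (hφ : IsYoungFunction φ)
    {T : Type*} [TopologicalSpace T] [TopologicalSpace.SeparableSpace T] {X : T → Ω → ℝ}
    (hX_cont : ∀ᵐ ω ∂μ, Continuous fun p => X p ω) {ε θ u : ℝ} (hε : 0 ≤ ε) (hθ : 0 < θ)
    (hθ1 : θ < 1) (hu : 0 ≤ u) (hX : ∀ p, HasMGFBound φ μ (X p) ε) {r N : ℝ → ℝ}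
    (hr_mono : StrictMonoOn r (Ici 1)) (hr_convex : ConvexOn ℝ (Ici 0) (fun x => r (Real.exp x)))
    (hN_one : ∀ v ∈ Ioc 0 (θ * ε), 1 ≤ N v) (hN : AntitoneOn N (Ioc 0 (θ * ε)))
    (hint : IntervalIntegrable (fun v => r (N v)) volume 0 (θ * ε))
    (hnet : ∀ v ∈ Ioc 0 (θ * ε), ∃ V : Finset T, (V.card : ℝ) ≤ N v ∧
      ∀ p, ∃ q ∈ V, HasMGFBound φ μ (fun ω => X p ω - X q ω) v) :
    μ {ω | ∃ p, u < |X p ω|} ≤ ENNReal.ofReal (2 * (Real.exp (-conj φ (u * (1 - θ) / ε)) *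
      invR r ((∫ v in (0 : ℝ)..(θ * ε), r (N v)) / (θ * ε)))) := by
  refine measure_exists_lt_abs_le_of_forall_finset hX_cont fun F => ?_
  rcases hε.eq_or_lt with rfl | hε
  · exact (measure_exists_lt_abs_eq_zero hφ.zero hX F hu).trans_le zero_le
  · exact measure_exists_lt_abs_le_invR_integral hφ hε hθ hθ1 hu hX hr_mono hr_convex hN_one hN
      hint hnet F

theorem hasMGFBound_sSup_tau {T : Type*} {S : Set T} {X : T → Ω → ℝ} (hφ : IsYoungFunction φ)
    {M : ℝ} (hM : 0 < M) (hX : ∀ p ∈ S, HasMGFBound φ μ (X p) M) {p : T} (hp : p ∈ S) :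
    HasMGFBound φ μ (X p) (sSup ((fun q => tau φ μ (X q)) '' S)) := by
  have hbdd : BddAbove ((fun q => tau φ μ (X q)) '' S) :=
    ⟨M, forall_mem_image.2 fun q hq => (hX q hq).tau_le hφ hM.le⟩
  have hle : tau φ μ (X p) ≤ sSup ((fun q => tau φ μ (X q)) '' S) :=
    le_csSup hbdd (mem_image_of_mem _ hp)
  exact ((hX p hp).hasMGFBound_tau hφ.continuous hM).mono hφ
    (abs_le_abs_of_nonneg (tau_nonneg _) hle)

end Separability

theorem setOf_ofReal_lt_iSup_eq {Ω : Type*} (U : ℝ → ℝ → Ω → ℝ) (s t : Set ℝ) {u : ℝ}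
    (hu : 0 ≤ u) :
    {ω | ENNReal.ofReal u < ⨆ x ∈ s, ⨆ y ∈ t, ENNReal.ofReal |U x y ω|} =
      {ω | ∃ p : ↥(s ×ˢ t), u < |U p.1.1 p.1.2 ω|} := by
  ext ω
  simp only [mem_ofPred_eq, lt_iSup_iff, ENNReal.ofReal_lt_ofReal_iff_of_nonneg hu, Subtype.exists,
    Prod.exists, mem_prod, exists_prop, and_assoc, exists_and_left]

section Field

variable {Ω : Type*} [MeasurableSpace Ω] {μ : Measure Ω} [IsProbabilityMeasure μ] {φ Z : ℝ → ℝ}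
  {u₀ : ℝ} {y : ℝ → Ω → ℝ} {Cy : ℝ} {κ ψ : ℝ → ℝ} {a b c d : ℝ} {U : ℝ → ℝ → Ω → ℝ}

variable (hφ : IsYoungFunction φ) (hZ : IsScaleFunction Z u₀)
  (hy : IsStrictlyPhiSubGaussian φ μ y Cy) (hκ : IsChordLipschitz κ) (hψ : Continuous ψ)
  (hfin : varIntegral (covFun μ y)
    (fun l m => ENNReal.ofReal (phaseWeight Z u₀ ψ l * phaseWeight Z u₀ ψ m)) < ∞)
  (hrect : 0 < max (b - a) (d - c))
  (hU : ∀ t ∈ Icc a b, ∀ x ∈ Icc c d, IsMSIntegral μ (fun l => κ (l * x + t * ψ l)) y (U t x))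
include hφ hZ hy hκ hψ hfin hrect hU

theorem hasMGFBound_sub_of_mem_rect {p q : ℝ × ℝ} (hp : p ∈ Icc a b ×ˢ Icc c d)
    (hq : q ∈ Icc a b ×ˢ Icc c d) : HasMGFBound φ μ (fun ω => U p.1 p.2 ω - U q.1 q.2 ω)
      (sigma Z u₀ (Cy * variationNorm (covFun μ y) (phaseWeight Z u₀ ψ))
        (max (b - a) (d - c))) :=
  hZ.hasMGFBound_sub hφ hy hκ hψ hfin hrect
    ((Real.dist_le_of_mem_Icc hp.1 hq.1).trans (le_max_left _ _))
    ((Real.dist_le_of_mem_Icc hp.2 hq.2).trans (le_max_right _ _))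
    (hU _ hp.1 _ hp.2) (hU _ hq.1 _ hq.2)

variable (hab : a ≤ b) (hcd : c ≤ d)
include hab hcd

theorem exists_hasMGFBound_of_mem_rect :
    ∃ M : ℝ, 0 < M ∧ ∀ p ∈ Icc a b ×ˢ Icc c d, HasMGFBound φ μ (U p.1 p.2) M := by
  have hcorner : (a, c) ∈ Icc a b ×ˢ Icc c d := ⟨left_mem_Icc.2 hab, left_mem_Icc.2 hcd⟩
  have hU₀ := (hU a hcorner.1 c hcorner.2).hasMGFBound hφ hy
  set K := Cy * (eLpNorm (U a c) 2 μ).toReal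
  set s := sigma Z u₀ (Cy * variationNorm (covFun μ y) (phaseWeight Z u₀ ψ)) (max (b - a) (d - c))
  -- Both bounds are made positive, for the weights in Hölder's inequality.
  have hle_succ (x : ℝ) : |x| ≤ |(|x| + 1)| := (lt_add_one |x|).le.trans (le_abs_self _)
  refine ⟨|s| + 1 + (|K| + 1), by positivity, fun p hp => ?_⟩
  have hincr := hasMGFBound_sub_of_mem_rect hφ hZ hy hκ hψ hfin hrect hU hp hcorner
  simpa only [sub_add_cancel] using
    (hincr.mono hφ (hle_succ s)).add (hU₀.mono hφ (hle_succ K)) (by positivity) (by positivity)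

theorem hasMGFBound_eps0 {p : ℝ × ℝ} (hp : p ∈ Icc a b ×ˢ Icc c d) :
    HasMGFBound φ μ (U p.1 p.2) (eps0 φ μ U a b c d) := by
  obtain ⟨M, hM, hUM⟩ := exists_hasMGFBound_of_mem_rect hφ hZ hy hκ hψ hfin hrect hU hab hcd
  exact hasMGFBound_sSup_tau hφ hM hUM hp

theorem exists_net_field {v : ℝ} (hv : 0 < v) : ∃ V : Finset ↥(Icc a b ×ˢ Icc c d),
    (V.card : ℝ) ≤ coverBound Z u₀ (Cy * variationNorm (covFun μ y) (phaseWeight Z u₀ ψ))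
        (b - a) (d - c) v ∧
      ∀ p : ↥(Icc a b ×ˢ Icc c d), ∃ q ∈ V,
        HasMGFBound φ μ (fun ω => U p.1.1 p.1.2 ω - U q.1.1 q.1.2 ω) v := by
  rcases le_or_gt v (sigma Z u₀ (Cy * variationNorm (covFun μ y) (phaseWeight Z u₀ ψ))
    (max (b - a) (d - c))) with hvH | hvH
  · have hh := (hZ.one_div_invRadius_mem_Ioc hrect hv hvH).1
    obtain ⟨V, hV_card, hV⟩ := exists_net_rect hab hcd hh
    refine ⟨V, hV_card.trans_eq (coverBound_eq_of_invRadius rfl).symm, fun p => ?_⟩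
    obtain ⟨q, hq, ht, hx⟩ := hV p
    refine ⟨q, hq, ?_⟩
    simpa only [hZ.sigma_one_div_invRadius hrect hv hvH] using hZ.hasMGFBound_sub hφ hy hκ hψ hfin
      hh ht hx (hU _ p.2.1 _ p.2.2) (hU _ q.2.1 _ q.2.2)
  · have hcorner : (a, c) ∈ Icc a b ×ˢ Icc c d := ⟨left_mem_Icc.2 hab, left_mem_Icc.2 hcd⟩
    refine ⟨{⟨(a, c), hcorner⟩}, ?_, fun p => ⟨_, Finset.mem_singleton_self _, ?_⟩⟩
    · rw [coverBound_of_sigma_lt hvH, Finset.card_singleton, Nat.cast_one]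
    · exact (hasMGFBound_sub_of_mem_rect hφ hZ hy hκ hψ hfin hrect hU p.2 hcorner).mono hφ
        (abs_le_abs_of_nonneg (hZ.sigma_nonneg (mul_nonneg hy.nonneg (Real.sqrt_nonneg _)) hrect)
          hvH.le)

end Field

end PhiSub

theorem theorem3_general {Ω : Type*} [MeasurableSpace Ω] (μ : Measure Ω) [IsProbabilityMeasure μ]
    (φ : ℝ → ℝ) (hφ : PhiSub.IsYoungFunction φ)
    (Z : ℝ → ℝ) (u₀ : ℝ) (hZ : PhiSub.IsScaleFunction Z u₀)
    (y : ℝ → Ω → ℝ) (Cy : ℝ) (hy : PhiSub.IsStrictlyPhiSubGaussian φ μ y Cy)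
    (κ : ℝ → ℝ) (hκ : PhiSub.IsChordLipschitz κ) (ψ : ℝ → ℝ) (hψ : Continuous ψ)
    (a b c d : ℝ) (hab : a ≤ b) (hcd : c ≤ d) (hrect : 0 < max (b - a) (d - c))
    (U : ℝ → ℝ → Ω → ℝ)
    (hU : ∀ t ∈ Icc a b, ∀ x ∈ Icc c d,
      PhiSub.IsMSIntegral μ (fun l => κ (l * x + t * ψ l)) y (U t x))
    (hUcont : ∀ᵐ ω ∂μ, ContinuousOn (fun p : ℝ × ℝ => U p.1 p.2 ω) (Icc a b ×ˢ Icc c d))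
    (hfin : PhiSub.varIntegral (PhiSub.covFun μ y) (fun l m =>
      ENNReal.ofReal (PhiSub.phaseWeight Z u₀ ψ l * PhiSub.phaseWeight Z u₀ ψ m)) < ∞)
    (CZ : ℝ) (hCZ : CZ = PhiSub.variationNorm (PhiSub.covFun μ y) (PhiSub.phaseWeight Z u₀ ψ))
    (γ₀ : ℝ) (hγ₀ : γ₀ = 2 * Cy * CZ / Z (1 / max (b - a) (d - c) + u₀))
    (ε₀ : ℝ) (hε₀ : ε₀ = PhiSub.eps0 φ μ U a b c d)
    (r : ℝ → ℝ) (hr_mono : StrictMonoOn r (Ici 1))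
    (hr_convex : ConvexOn ℝ (Ici 0) (fun x => r (Real.exp x)))
    (hentropy : ∀ ε, 0 < ε → ε ≤ γ₀ →
      IntegrableOn (PhiSub.entropyIntegrand r (PhiSub.sigma Z u₀ (Cy * CZ)) (b - a) (d - c))
        (Ioc 0 ε))
    (θ u : ℝ) (hθ : 0 < θ) (hθ1 : θ < 1) (hu : 0 ≤ u) :
    μ {ω | ENNReal.ofReal u < ⨆ t ∈ Icc a b, ⨆ x ∈ Icc c d, ENNReal.ofReal |U t x ω|} ≤
      ENNReal.ofReal (2 * (Real.exp (-PhiSub.conj φ (u * (1 - θ) / ε₀)) *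
        PhiSub.invR r
          ((PhiSub.hatI r Z u₀ (Cy * CZ) (b - a) (d - c) (min (θ * ε₀) γ₀)
              + r 1 * max (θ * ε₀ - γ₀) 0) / (θ * ε₀)))) := by
  have hC : 0 ≤ Cy * CZ := mul_nonneg hy.nonneg (hCZ ▸ Real.sqrt_nonneg _)
  have hγ₀ : γ₀ = PhiSub.sigma Z u₀ (Cy * CZ) (max (b - a) (d - c)) := by
    rw [hγ₀, PhiSub.sigma, mul_assoc]
  have hε₀_nonneg : 0 ≤ ε₀ :=
    hε₀ ▸ Real.sSup_nonneg (forall_mem_image.2 fun _ _ => PhiSub.tau_nonneg _)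
  have hE : 0 ≤ θ * ε₀ := mul_nonneg hθ.le hε₀_nonneg
  subst hγ₀
  rw [PhiSub.setOf_ofReal_lt_iSup_eq U _ _ hu, ← hZ.integral_coverBound hrect hC hE hentropy]
  subst hCZ hε₀
  refine PhiSub.measure_exists_lt_abs_le_of_continuous hφ
    (hUcont.mono fun _ => continuousOn_iff_continuous_domRestrict.1) hε₀_nonneg hθ hθ1 hu
    (fun p => PhiSub.hasMGFBound_eps0 hφ hZ hy hκ hψ hfin hrect hU hab hcd p.2) hr_mono hr_convex
    (fun v hv => hZ.one_le_coverBound (sub_nonneg.2 hab) (sub_nonneg.2 hcd) hrect hv.1)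
    ((hZ.antitoneOn_coverBound (sub_nonneg.2 hab) (sub_nonneg.2 hcd) hrect).mono
      Ioc_subset_Ioi_self)
    (hZ.intervalIntegrable_coverBound hrect hC hE hentropy)
    fun v hv => PhiSub.exists_net_field hφ hZ hy hκ hψ hfin hrect hU hab hcd hv.1

theorem theorem3 {Ω : Type*} [MeasurableSpace Ω] (μ : Measure Ω) [IsProbabilityMeasure μ]
    -- the `N`-function and the admissible function
    (φ : ℝ → ℝ) (hφ : PhiSub.IsNFunctionQ φ)
    (Z : ℝ → ℝ) (u₀ : ℝ) (hZ : PhiSub.IsAdmissible φ Z u₀)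
    -- the process `y`
    (y : ℝ → Ω → ℝ) (Cy : ℝ) (hy : PhiSub.IsStrictlyPhiSubGaussian φ μ y Cy)
    (hvar : PhiSub.HasFiniteVitaliVariation (PhiSub.covFun μ y))
    -- the field `U` on the rectangle `[a, b] × [c, d]`
    (κ : ℝ → ℝ) (hκ : κ = Real.cos ∨ κ = Real.sin) (N : ℕ) (α : ℕ → ℝ)
    (a b c d : ℝ) (hab : a ≤ b) (hcd : c ≤ d) (hrect : 0 < max (b - a) (d - c))
    (U : ℝ → ℝ → Ω → ℝ)
    (hU : ∀ t ∈ Icc a b, ∀ x ∈ Icc c d,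
      PhiSub.IsMSIntegral μ (PhiSub.kernelI κ N α t x) y (U t x))
    (hUcont : ∀ᵐ ω ∂μ, ContinuousOn (fun p : ℝ × ℝ => U p.1 p.2 ω) (Icc a b ×ˢ Icc c d))
    -- convergence of the integral `C_Z ^ 2`, and the constants `C_Z`, `γ₀`, `ε₀`
    (hCZ : PhiSub.CZsq (PhiSub.covFun μ y) Z u₀ N α < ∞)
    (CZ : ℝ) (hCZ_def : CZ = PhiSub.CZ (PhiSub.covFun μ y) Z u₀ N α)
    (γ₀ : ℝ) (hγ₀ : γ₀ = 2 * Cy * CZ / Z (1 / max (b - a) (d - c) + u₀))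
    (ε₀ : ℝ) (hε₀ : ε₀ = PhiSub.eps0 φ μ U a b c d)
    -- the function `r` and the entropy condition
    (r : ℝ → ℝ) (hr_nonneg : ∀ x, 1 ≤ x → 0 ≤ r x) (hr_mono : StrictMonoOn r (Ici 1))
    (hr_convex : ConvexOn ℝ (Ici 0) (fun x => r (Real.exp x)))
    (hentropy : ∀ ε, 0 < ε → ε ≤ γ₀ →
      IntegrableOn (PhiSub.entropyIntegrand r (PhiSub.sigma Z u₀ (Cy * CZ)) (b - a) (d - c))
        (Ioc 0 ε)) :
    ∀ θ u : ℝ, 0 < θ → θ < 1 → 0 < u →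
      μ {ω | ENNReal.ofReal u < ⨆ t ∈ Icc a b, ⨆ x ∈ Icc c d, ENNReal.ofReal |U t x ω|} ≤
        ENNReal.ofReal (2 * (Real.exp (-PhiSub.conj φ (u * (1 - θ) / ε₀)) *
          PhiSub.invR r
            ((PhiSub.hatI r Z u₀ (Cy * CZ) (b - a) (d - c) (min (θ * ε₀) γ₀)
                + r 1 * max (θ * ε₀ - γ₀) 0) / (θ * ε₀)))) :=
  fun θ u hθ hθ1 hu => theorem3_general μ φ hφ.isYoungFunction Z u₀ hZ.isScaleFunction y Cy hy κ
    (hκ.elim (· ▸ PhiSub.isChordLipschitz_cos) (· ▸ PhiSub.isChordLipschitz_sin)) _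
    (PhiSub.continuous_symb N α) a b c d hab hcd hrect U hU hUcont hCZ CZ hCZ_def γ₀ hγ₀ ε₀ hε₀ r
    hr_mono hr_convex hentropy θ u hθ hθ1 hu.le
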